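/- Let $d\ge 1$ and let $\|\cdot\|$ be any norm on $\mathbb R^d$ (the source norm); $\langle\cdot,\cdot\rangle$ is the usual scalar product. For $x\in\mathbb R^d$ let $\ell_0(x)\in\{0,\dots,d\}$ be the number of nonzero components of $x$. On $[-\infty,+\infty]$ use the lower addition ($(+\infty)+(-\infty)=-\infty$) and the upper addition $\dot+$ ($(+\infty)\,\dot+\,(-\infty)=+\infty$). Infima over the empty set, and minima over an empty feasible set, are $+\infty$. $\delta_S$ is $0$ on $S$ and $+\infty$ outside $S$. *Conjugacies.* For a coupling $c:\mathbb R^d\times\mathbb R^d\to\mathbb R$ and $f,g:\mathbb R^d\to[-\infty,+\infty]$ put $f^{c}(y)=\sup_x\big(c(x,y)+(-f(x))\big)$, $g^{c'}(x)=\sup_y\big(c(x,y)+(-g(y))\big)$, $f^{cc'}=(f^c)^{c'}$. For $c(x,y)=\langle x,y\rangle$ these are the Fenchel (reverse, bi-)conjugates $f^\star$, $g^{\star'}$, $f^{\star\star'}$. The Capra coupling is $¢(x,y)=\langle x,y\rangle/\|x\|$ for $x\ne0$ and $¢(0,y)=0$. A function is closed convex if its epigraph is convex and it is either lower semicontinuous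 (lsc) and nowhere $-\infty$, or the constant $-\infty$; it is proper if it never takes the value $-\infty$ and is not identically $+\infty$. *Coordinate norms.* For $K\subset\{1,\dots,d\}$ let $\mathcal R_K$ be the subspace of vectors vanishing outside $K$, $y_K$ the orthogonal projection of $y$ onto $\mathcal R_K$, and $\|y\|_{K,\star}=\sup\{\langle x,y\rangle: x\in\mathcal R_K,\ \|x\|\le1\}$ for $y\in\mathcal R_K$. For $1\le k\le d$ the dual coordinate-$k$ norm is $\|y\|^{\star}_{(k)}=\sup_{|K|\le k}\|y_K\|_{K,\star}$, and the coordinate-$k$ norm $\|\cdot\|_{(k)}$ is the norm whose dual norm is $\|\cdot\|^\star_{(k)}$. Let $B_k,S_k$ be the unit ball and unit sphere of $\|\cdot\|_{(k)}$, with the conventions $\|\cdot\|^\star_{(0)}=0$ and $B_0=S_0=\{0\}$. For $\varphi:\{0,\dots,d\}\to[-\infty,+\infty]$ let $F_\varphi=\big((\varphi\circ\ell_0)^{¢}\big)^{\star'}$. **1.** For every $\varphi:\{0,\dots,d\}\to[-\infty,+\infty]$: (a) $(\varphi\circ\ell_0)^{¢¢'}(x)=F_\varphi(x/\|x\|)$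 for all $x\neq0$, and $F_\varphi$ is closed convex. (b) $F_\varphi=\Big(\sup_{0\le l\le d}\big[\|\cdot\|^\star_{(l)}-\varphi(l)\big]\Big)^{\star'}$. (c) $F_\varphi=\Big(\inf_{0\le l\le d}[\delta_{B_l}\dot+\varphi(l)]\Big)^{\star\star'}=\Big(x\mapsto\inf\{\varphi(l): x\in B_l,\ 0\le l\le d\}\Big)^{\star\star'}$. The two functions in brackets, call them $h$, coincide, and $F_\varphi$ is the largest closed convex function below $h$. For $1\le l\le d$, $h(x)=\inf_{j\ge l}\varphi(j)$ for $x\in B_l\setminus B_{l-1}$; $h(0)=\inf_{0\le j\le d}\varphi(j)$; in particular, if $\varphi$ is nondecreasing, $h=\varphi(l)$ on $B_l\setminus B_{l-1}$ and $h(0)=\varphi(0)$. Moreover $B_d=\{x:\|x\|\le 1\}$ and $h=+\infty$ outside $B_d$. (d) $F_\varphi=\Big(\inf_{0\le l\le d}[\delta_{S_l}\dot+\varphi(l)]\Big)^{\star\star'}=\Big(x\mapsto\inf\{\varphi(l): x\in S_l,\ 0\le l\le d\}\Big)^{\star\star'}$; the two functions in brackets coincide and $F_\varphi$ is the largest closed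 convex function below them. **2.** For every $\varphi:\{0,\dots,d\}\to\mathbb R$, the function $F_\varphi$ is proper convex lsc and, with $\Delta_{d+1}$ the simplex of $\mathbb R^{d+1}$, for all $x\in\mathbb R^d$, $$F_\varphi(x)=\min\Big\{\sum_{l=0}^d\lambda_l\varphi(l)\;:\;(\lambda_0,\dots,\lambda_d)\in\Delta_{d+1},\ x\in\sum_{l=1}^d\lambda_lB_l\Big\}.$$ **3.** For every $\varphi:\{0,\dots,d\}\to[0,+\infty)$ with $\varphi(0)=0$, the function $F_\varphi$ is proper convex lsc and, for all $x\in\mathbb R^d$, $$F_\varphi(x)=\min\Big\{\sum_{l=1}^d\lambda_l\varphi(l)\;:\;(\lambda_0,\dots,\lambda_d)\in\Delta_{d+1},\ x\in\sum_{l=1}^d\lambda_lS_l\Big\}$$ $$=\min\Big\{\sum_{l=1}^d\varphi(l)\|z^{(l)}\|_{(l)}\;:\;z^{(1)},\dots,z^{(d)}\in\mathbb R^d,\ \sum_{l=1}^d\|z^{(l)}\|_{(l)}\le1,\ \sum_{l=1}^dz^{(l)}=x\Big\},$$ and for all $x\ne0$ $$(\varphi\circ\ell_0)^{¢¢'}(x)=\frac1{\|x\|}\min\Big\{\sum_{l=1}^d\|z^{(l)}\|_{(l)}\varphi(l)\;:\;z^{(1)},\dots,z^{(d)}\in\mathbb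 R^d,\ \sum_{l=1}^d\|z^{(l)}\|_{(l)}\le\|x\|,\ \sum_{l=1}^dz^{(l)}=x\Big\}.$$ All minima over nonempty feasible sets are attained; in the last formula the feasible set is nonempty. -/

import Mathlib

open scoped Pointwise

namespace Capra

noncomputable section

/-! ## Fenchel-Moreau conjugacies

Addition of `EReal` satisfies `⊤ + ⊥ = ⊥ + ⊤ = ⊥`, hence it is the Moreau lower addition. -/

/-- Moreau upper addition on the extended reals: `⊤ ∔ ⊥ = ⊥ ∔ ⊤ = ⊤`. -/
def upAdd (a b : EReal) : EReal := -(-a + -b)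

/-- The Fenchel-Moreau conjugate of `f` with respect to the coupling `c`. -/
def coupConj {X Y : Type*} (c : X → Y → EReal) (f : X → EReal) (y : Y) : EReal :=
  ⨆ x, (c x y + -f x)

/-- The conjugate of `g` with respect to the reverse coupling of `c`. -/
def coupConjRev {X Y : Type*} (c : X → Y → EReal) (g : Y → EReal) : X → EReal :=
  coupConj (fun y x => c x y) g

/-- The Fenchel-Moreau biconjugate of `f` with respect to the coupling `c`. -/
def coupBiconj {X Y : Type*} (c : X → Y → EReal) (f : X → EReal) : X → EReal :=
  coupConjRev c (coupConj c f)

/-- The bilinear coupling `⟨x, y⟩`, which induces the Fenchel conjugacy. -/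
def fenchel {d : ℕ} (x y : Fin d → ℝ) : EReal := ((x ⬝ᵥ y : ℝ) : EReal)

/-- The constant along primal rays coupling: `⟨x, y⟩ / N x` if `x ≠ 0`, and `0` if `x = 0`. -/
def capra {d : ℕ} (N : (Fin d → ℝ) → ℝ) (x y : Fin d → ℝ) : EReal :=
  open Classical in ((if x = 0 then 0 else (x ⬝ᵥ y) / N x : ℝ) : EReal)

/-- The characteristic function of a set: `0` on the set and `+∞` outside of it. -/
def charFn {X : Type*} (S : Set X) (x : X) : EReal :=
  open Classical in if x ∈ S then 0 else ⊤

/-! ## Closed convex functions -/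

def epigraph {X : Type*} (f : X → EReal) : Set (X × ℝ) := {p | f p.1 ≤ (p.2 : EReal)}

def IsConvexFn {d : ℕ} (f : (Fin d → ℝ) → EReal) : Prop := Convex ℝ (epigraph f)

def IsLscFn {d : ℕ} (f : (Fin d → ℝ) → EReal) : Prop := IsClosed (epigraph f)

def IsProperFn {d : ℕ} (f : (Fin d → ℝ) → EReal) : Prop :=
  (∀ x, f x ≠ ⊥) ∧ ∃ x, f x < ⊤

def IsClosedFn {d : ℕ} (f : (Fin d → ℝ) → EReal) : Prop :=
  (IsLscFn f ∧ ∀ x, f x ≠ ⊥) ∨ ∀ x, f x = ⊥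

def IsClosedConvexFn {d : ℕ} (f : (Fin d → ℝ) → EReal) : Prop :=
  IsConvexFn f ∧ IsClosedFn f

/-- `v` is the minimum of `f` over `S`: it is attained if `S` is nonempty, and it is `+∞`
if `S` is empty. -/
def IsMinOver {ι : Type*} (S : Set ι) (f : ι → ℝ) (v : EReal) : Prop :=
  (S.Nonempty → IsLeast ((fun i => (f i : EReal)) '' S) v) ∧ (S = ∅ → v = ⊤)

/-! ## The l0 pseudonorm -/

/-- The number of nonzero components of `x`, as an element of `{0, 1, …, d}`. -/
def ell0 {d : ℕ} (x : Fin d → ℝ) : Fin (d + 1) :=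
  ⟨(Finset.univ.filter (fun j => x j ≠ 0)).card,
    Nat.lt_succ_of_le ((Finset.card_le_univ _).trans_eq (Fintype.card_fin d))⟩

/-! ## Coordinate norms -/

/-- The subspace of the vectors whose components vanish outside of `K`. -/
def flat {d : ℕ} (K : Finset (Fin d)) : Submodule ℝ (Fin d → ℝ) where
  carrier := {x | ∀ j, j ∉ K → x j = 0}
  add_mem' := fun hx hy j hj => by simp [hx j hj, hy j hj]
  zero_mem' := fun _ _ => rfl
  smul_mem' := fun c x hx j hj => by simp [hx j hj]

/-- The orthogonal projection onto `flat K`. -/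
def proj {d : ℕ} (K : Finset (Fin d)) (x : Fin d → ℝ) : Fin d → ℝ :=
  fun j => if j ∈ K then x j else 0

/-- The dual norm on the subspace `V` of the restriction of `N` to `V`. -/
def dualNormOn {d : ℕ} (V : Submodule ℝ (Fin d → ℝ)) (N : (Fin d → ℝ) → ℝ)
    (y : Fin d → ℝ) : ℝ :=
  sSup {r | ∃ x ∈ V, N x ≤ 1 ∧ r = x ⬝ᵥ y}

/-- The dual norm of `N`. -/
def dualNorm {d : ℕ} (N : (Fin d → ℝ) → ℝ) (y : Fin d → ℝ) : ℝ := dualNormOn ⊤ N y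

/-- The dual coordinate-`k` norm of the source norm `N`: the supremum over the sets `K` of at
most `k` coordinates of the dual norm, on `flat K`, of the restriction of `N`.
It is `0` for `k = 0`. -/
def dualCoordNorm {d : ℕ} (N : (Fin d → ℝ) → ℝ) (k : ℕ) (y : Fin d → ℝ) : ℝ :=
  sSup {r | ∃ K : Finset (Fin d), K.card ≤ k ∧ r = dualNormOn (flat K) N (proj K y)}

/-- The coordinate-`k` norm of the source norm `N`, for `1 ≤ k`: the norm whose dual norm is the
dual coordinate-`k` norm (see `dualNorm_coordNorm`). It is built as the dual norm of the latter. -/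
def coordNorm {d : ℕ} (N : (Fin d → ℝ) → ℝ) (k : ℕ) : (Fin d → ℝ) → ℝ :=
  dualNorm (dualCoordNorm N k)

/-- The unit ball of the coordinate-`k` norm, with the convention `{0}` for `k = 0`. -/
def coordBall {d : ℕ} (N : (Fin d → ℝ) → ℝ) (k : ℕ) : Set (Fin d → ℝ) :=
  if k = 0 then {0} else {x | coordNorm N k x ≤ 1}

/-- The unit sphere of the coordinate-`k` norm, with the convention `{0}` for `k = 0`. -/
def coordSphere {d : ℕ} (N : (Fin d → ℝ) → ℝ) (k : ℕ) : Set (Fin d → ℝ) :=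
  if k = 0 then {0} else {x | coordNorm N k x = 1}

/-! ## Functions of the l0 pseudonorm -/

/-- The Fenchel conjugate of the Capra conjugate of `φ ∘ ell0`. -/
def capraFenchel {d : ℕ} (N : (Fin d → ℝ) → ℝ) (φ : Fin (d + 1) → EReal) :
    (Fin d → ℝ) → EReal :=
  coupConjRev fenchel (coupConj (capra N) (φ ∘ ell0))

/-- The function `inf_{l = 0, …, d} (δ_{B l} ∔ φ l)`. -/
def infChar {d : ℕ} (B : ℕ → Set (Fin d → ℝ)) (φ : Fin (d + 1) → EReal)
    (x : Fin d → ℝ) : EReal :=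
  ⨅ l : Fin (d + 1), upAdd (charFn (B l) x) (φ l)

/-- The function `x ↦ inf {φ l | x ∈ B l, l = 0, …, d}`. -/
def infOver {d : ℕ} (B : ℕ → Set (Fin d → ℝ)) (φ : Fin (d + 1) → EReal)
    (x : Fin d → ℝ) : EReal :=
  sInf {a | ∃ l : Fin (d + 1), x ∈ B l ∧ a = φ l}

/-! ## The coordinate norms are well defined -/

lemma dualCoordNorm_zero {d : ℕ} (N : Seminorm ℝ (Fin d → ℝ)) (y : Fin d → ℝ) :
    dualCoordNorm N 0 y = 0 := by
  have h0 : dualNormOn (flat (∅ : Finset (Fin d))) N (proj ∅ y) = 0 := by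
    have : {r : ℝ | ∃ x ∈ flat (∅ : Finset (Fin d)), N x ≤ 1 ∧ r = x ⬝ᵥ proj ∅ y} = {0} := by
      have hp : proj ∅ y = 0 := by ext; simp [proj]
      ext r
      constructor
      · rintro ⟨x, -, -, rfl⟩
        simp [hp]
      · rintro rfl
        exact ⟨0, Submodule.zero_mem _, by simp, by simp⟩
    rw [dualNormOn, this, csSup_singleton]
  have : {r : ℝ | ∃ K : Finset (Fin d), K.card ≤ 0 ∧ r = dualNormOn (flat K) N (proj K y)}
      = {0} := by
    ext r
    constructor
    · rintro ⟨K, hK, rfl⟩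
      obtain rfl := Finset.card_eq_zero.mp (Nat.le_zero.mp hK)
      exact h0
    · rintro rfl
      exact ⟨∅, by simp, h0.symm⟩
  rw [dualCoordNorm, this, csSup_singleton]

/-- The supremum of `⟨x, y⟩` over `x ∈ S`. -/
def supp {d : ℕ} (S : Set (Fin d → ℝ)) (y : Fin d → ℝ) : ℝ := sSup {r | ∃ x ∈ S, r = x ⬝ᵥ y}

/-- A definite seminorm bounds the coordinates. -/
lemma exists_bound {d : ℕ} (N : Seminorm ℝ (Fin d → ℝ)) (hN : ∀ x, N x = 0 → x = 0) :
    ∃ C : ℝ, ∀ x, N x ≤ 1 → ‖x‖ ≤ C := by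
  have hle : ∀ x, N x ≤ (∑ i, N (Pi.single i 1)) * ‖x‖ := by
    intro x
    have hx : x = ∑ i, x i • (Pi.single i 1 : Fin d → ℝ) := by
      ext j
      simp [Finset.sum_apply, Pi.single_apply]
    calc N x = N (∑ i, x i • (Pi.single i 1 : Fin d → ℝ)) := by rw [← hx]
      _ ≤ ∑ i, N (x i • (Pi.single i 1 : Fin d → ℝ)) := Finset.le_sum_of_subadditive N (map_zero N).le (map_add_le_add N) _ _
      _ ≤ ∑ i, N (Pi.single i 1) * ‖x‖ := by
          refine Finset.sum_le_sum fun i _ => ?_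
          rw [map_smul_eq_mul, mul_comm]
          exact mul_le_mul_of_nonneg_left (norm_le_pi_norm x i) (apply_nonneg N _)
      _ = _ := (Finset.sum_mul _ _ _).symm
  have hcont : Continuous N := by
    refine Seminorm.continuous_of_le
      (q := (∑ i, N (Pi.single i 1)).toNNReal • normSeminorm ℝ (Fin d → ℝ)) ?_ ?_
    · exact (continuous_norm.const_smul (∑ i, N (Pi.single i 1)).toNNReal)
    · intro x
      have h0 : 0 ≤ ∑ i, N (Pi.single i 1 : Fin d → ℝ) :=
        Finset.sum_nonneg fun i _ => apply_nonneg N _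
      have := hle x
      simpa [NNReal.smul_def, Real.coe_toNNReal _ h0] using this
  rcases (Metric.sphere (0 : Fin d → ℝ) 1).eq_empty_or_nonempty with hS | hS
  · refine ⟨0, fun x _ => ?_⟩
    by_contra hx
    have hx' : ‖x‖ ≠ 0 := fun h => hx h.le
    have : ‖x‖⁻¹ • x ∈ Metric.sphere (0 : Fin d → ℝ) 1 := by
      simp [norm_smul, inv_mul_cancel₀ hx']
    rw [hS] at this
    exact this
  · obtain ⟨u, hu, hmin⟩ :=
      (isCompact_sphere (0 : Fin d → ℝ) 1).exists_isMinOn hS hcont.continuousOn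
    have hu1 : ‖u‖ = 1 := by simpa using hu
    have hpos : 0 < N u := by
      refine lt_of_le_of_ne (apply_nonneg N u) fun h => ?_
      rw [hN u h.symm, norm_zero] at hu1
      exact zero_ne_one hu1
    refine ⟨(N u)⁻¹, fun x hx => ?_⟩
    by_cases hx0 : ‖x‖ = 0
    · rw [hx0]; positivity
    have hmem : ‖x‖⁻¹ • x ∈ Metric.sphere (0 : Fin d → ℝ) 1 := by
      simp [norm_smul, inv_mul_cancel₀ hx0]
    have h1 : N u ≤ ‖x‖⁻¹ * N x := by
      have := hmin hmem
      simpa [map_smul_eq_mul] using this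
    have hxp : 0 < ‖x‖ := lt_of_le_of_ne (norm_nonneg x) (Ne.symm hx0)
    rw [← div_eq_inv_mul, le_div_iff₀ hxp] at h1
    rw [inv_eq_one_div, le_div_iff₀ hpos]
    linarith

lemma supp_bddAbove {d : ℕ} {S : Set (Fin d → ℝ)} {C : ℝ} (hC : ∀ x ∈ S, ‖x‖ ≤ C)
    (y : Fin d → ℝ) : BddAbove {r | ∃ x ∈ S, r = x ⬝ᵥ y} := by
  refine ⟨∑ i, C * |y i|, ?_⟩
  rintro r ⟨x, hx, rfl⟩
  refine Finset.sum_le_sum fun i _ => (le_abs_self _).trans ?_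
  rw [abs_mul]
  exact mul_le_mul_of_nonneg_right ((norm_le_pi_norm x i).trans (hC x hx)) (abs_nonneg _)

lemma le_supp {d : ℕ} {S : Set (Fin d → ℝ)} {C : ℝ} (hC : ∀ x ∈ S, ‖x‖ ≤ C)
    {x : Fin d → ℝ} (hx : x ∈ S) (y : Fin d → ℝ) : x ⬝ᵥ y ≤ supp S y :=
  le_csSup (supp_bddAbove hC y) ⟨x, hx, rfl⟩

lemma supp_le {d : ℕ} {S : Set (Fin d → ℝ)} (h0 : 0 ∈ S) {y : Fin d → ℝ} {b : ℝ}
    (h : ∀ x ∈ S, x ⬝ᵥ y ≤ b) : supp S y ≤ b :=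
  csSup_le ⟨_, 0, h0, rfl⟩ (by rintro r ⟨x, hx, rfl⟩; exact h x hx)

/-- The support function of a bounded symmetric set is a seminorm. -/
def suppSeminorm {d : ℕ} (S : Set (Fin d → ℝ)) (h0 : 0 ∈ S) (hneg : ∀ x ∈ S, -x ∈ S)
    (hb : ∃ C : ℝ, ∀ x ∈ S, ‖x‖ ≤ C) : Seminorm ℝ (Fin d → ℝ) :=
  Seminorm.ofSMulLE (supp S)
    (le_antisymm (supp_le h0 fun x _ => by simp)
      (by obtain ⟨C, hC⟩ := hb; simpa using le_supp hC h0 0))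
    (fun y z => by
      obtain ⟨C, hC⟩ := hb
      refine supp_le h0 fun x hx => ?_
      rw [dotProduct_add]
      exact add_le_add (le_supp hC hx y) (le_supp hC hx z))
    (fun r y => by
      obtain ⟨C, hC⟩ := hb
      refine supp_le h0 fun x hx => ?_
      rw [dotProduct_smul, smul_eq_mul, Real.norm_eq_abs]
      rcases le_total 0 r with hr | hr
      · rw [abs_of_nonneg hr]
        exact mul_le_mul_of_nonneg_left (le_supp hC hx y) hr
      · rw [abs_of_nonpos hr]
        have h := mul_le_mul_of_nonneg_left (le_supp hC (hneg x hx) y) (neg_nonneg.mpr hr)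
        rwa [neg_dotProduct, neg_mul_neg] at h)

/-- A norm is the dual norm of its dual norm. -/
lemma dualNorm_dualNorm {d : ℕ} (p : Seminorm ℝ (Fin d → ℝ)) (hp : ∀ x, p x = 0 → x = 0) :
    dualNorm (dualNorm p) = p := by
  obtain ⟨C, hC⟩ := exists_bound p hp
  have hdual : ∀ y, dualNorm p y = supp {x | p x ≤ 1} y := by
    intro y
    simp [dualNorm, dualNormOn, supp]
  have hpol : ∀ x y, dualNorm p y ≤ 1 → y ⬝ᵥ x ≤ p x := by
    intro x y hy
    rcases (apply_nonneg p x).eq_or_lt with h | h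
    · simp [hp x h.symm]
    · have hx : p ((p x)⁻¹ • x) ≤ 1 := by
        rw [map_smul_eq_mul, Real.norm_of_nonneg (by positivity), inv_mul_cancel₀ h.ne']
      have h1 := le_supp (S := {x | p x ≤ 1}) hC hx y
      rw [← hdual, smul_dotProduct, smul_eq_mul, ← div_eq_inv_mul, div_le_iff₀ h] at h1
      rw [dotProduct_comm]
      nlinarith
  have hzero : dualNorm p 0 ≤ 1 := by
    rw [hdual]
    exact supp_le (by simp) fun x _ => by simp
  funext x
  refine le_antisymm ?_ ?_
  · refine csSup_le ⟨_, 0, trivial, hzero, rfl⟩ ?_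
    rintro r ⟨y, -, hy, rfl⟩
    exact hpol x y hy
  · obtain ⟨f, hf, hfle⟩ : ∃ f : (Fin d → ℝ) →ₗ[ℝ] ℝ, f x = p x ∧ ∀ z, f z ≤ p z := by
      by_cases hx : x = 0
      · exact ⟨0, by simp [hx], fun z => apply_nonneg p z⟩
      obtain ⟨g, hg, hgle⟩ := exists_extension_of_le_sublinear
        (LinearPMap.mkSpanSingleton x (p x) hx) p
        (fun c hc z => by rw [map_smul_eq_mul, Real.norm_of_nonneg hc.le])
        (fun a b => map_add_le_add p a b) (by
          rintro ⟨z, hz⟩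
          obtain ⟨c, rfl⟩ := Submodule.mem_span_singleton.mp hz
          have h1 : (LinearPMap.mkSpanSingleton x (p x) hx : (Fin d → ℝ) →ₗ.[ℝ] ℝ) ⟨c • x, hz⟩
              = c • p x := LinearPMap.mkSpanSingleton'_apply _ _ _ c hz
          rw [h1, smul_eq_mul, map_smul_eq_mul]
          exact mul_le_mul_of_nonneg_right (le_abs_self c) (apply_nonneg p x))
      refine ⟨g, ?_, hgle⟩
      have hmem : x ∈ Submodule.span ℝ {x} := Submodule.mem_span_singleton_self x
      have := hg ⟨x, hmem⟩
      rw [this]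
      exact LinearPMap.mkSpanSingleton_apply ℝ ℝ hx (p x)
    set y : Fin d → ℝ := (dotProductEquiv ℝ (Fin d)).symm f with hy
    have hyf : ∀ z, y ⬝ᵥ z = f z := by
      intro z
      have : (dotProductEquiv ℝ (Fin d)) y = f := by simp [hy]
      rw [← this]
      rfl
    have hy1 : dualNorm p y ≤ 1 := by
      rw [hdual]
      refine supp_le (by simp) fun z hz => ?_
      rw [dotProduct_comm, hyf]
      exact (hfle z).trans hz
    refine le_csSup ⟨p x, ?_⟩ ⟨y, trivial, hy1, by rw [hyf, hf]⟩
    rintro r ⟨y', -, hy', rfl⟩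
    exact hpol x y' hy'

/-- For `1 ≤ k`, the dual coordinate-`k` norm is a norm. -/
lemma exists_dualCoordNorm_eq {d : ℕ} (N : Seminorm ℝ (Fin d → ℝ)) (hN : ∀ x, N x = 0 → x = 0)
    {k : ℕ} (hk : 1 ≤ k) :
    ∃ p : Seminorm ℝ (Fin d → ℝ), ⇑p = dualCoordNorm N k ∧ ∀ x, p x = 0 → x = 0 := by
  obtain ⟨C, hC⟩ := exists_bound N hN
  set S : Set (Fin d → ℝ) := {x | ∃ K : Finset (Fin d), K.card ≤ k ∧ x ∈ flat K ∧ N x ≤ 1}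
    with hS
  have h0 : (0 : Fin d → ℝ) ∈ S := ⟨∅, by simp, Submodule.zero_mem _, by simp⟩
  have hneg : ∀ x ∈ S, -x ∈ S := by
    rintro x ⟨K, hK, hx, hx1⟩
    exact ⟨K, hK, Submodule.neg_mem _ hx, by rwa [map_neg_eq_map]⟩
  have hb : ∀ x ∈ S, ‖x‖ ≤ C := by
    rintro x ⟨K, -, -, hx1⟩
    exact hC x hx1
  have hproj : ∀ (K : Finset (Fin d)) (x y : Fin d → ℝ), x ∈ flat K →
      x ⬝ᵥ proj K y = x ⬝ᵥ y := by
    intro K x y hx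
    refine Finset.sum_congr rfl fun j _ => ?_
    by_cases hj : j ∈ K
    · simp [proj, hj]
    · simp [hx j hj]
  have hinner : ∀ (K : Finset (Fin d)) (y : Fin d → ℝ), K.card ≤ k →
      dualNormOn (flat K) N (proj K y) ≤ supp S y := by
    intro K y hK
    refine csSup_le ⟨_, 0, Submodule.zero_mem _, by simp, rfl⟩ ?_
    rintro r ⟨x, hx, hx1, rfl⟩
    rw [hproj K x y hx]
    exact le_supp hb ⟨K, hK, hx, hx1⟩ y
  have heq : ∀ y, supp S y = dualCoordNorm N k y := by
    intro y
    refine le_antisymm (supp_le h0 ?_) (csSup_le ⟨_, ∅, by simp, rfl⟩ ?_)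
    · rintro x ⟨K, hK, hx, hx1⟩
      have h1 : x ⬝ᵥ y ≤ dualNormOn (flat K) N (proj K y) := by
        rw [← hproj K x y hx]
        refine le_csSup ?_ ⟨x, hx, hx1, rfl⟩
        refine (supp_bddAbove hb (proj K y)).mono ?_
        rintro r ⟨x', hx', hx1', rfl⟩
        exact ⟨x', ⟨K, hK, hx', hx1'⟩, rfl⟩
      refine h1.trans (le_csSup ⟨supp S y, ?_⟩ ⟨K, hK, rfl⟩)
      rintro r ⟨K', hK', rfl⟩
      exact hinner K' y hK'
    · rintro r ⟨K, hK, rfl⟩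
      exact hinner K y hK
  refine ⟨suppSeminorm S h0 hneg ⟨C, hb⟩, funext heq, fun y hy => ?_⟩
  have hy' : supp S y = 0 := hy
  funext j
  set e : Fin d → ℝ := Pi.single j 1 with he
  have hNe : 0 < N e := by
    refine lt_of_le_of_ne (apply_nonneg N e) fun h => ?_
    have := congrFun (hN e h.symm) j
    simp [he] at this
  have hmem : (N e)⁻¹ • e ∈ S := by
    refine ⟨{j}, by simpa using hk, ?_, ?_⟩
    · refine Submodule.smul_mem _ _ fun i hi => ?_
      have : i ≠ j := by simpa using hi
      simp [he, this]
    · rw [map_smul_eq_mul, Real.norm_of_nonneg (by positivity), inv_mul_cancel₀ hNe.ne']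
  have h1 := le_supp hb hmem y
  have h2 := le_supp hb (hneg _ hmem) y
  rw [hy'] at h1 h2
  have h3 : ((N e)⁻¹ • e) ⬝ᵥ y = (N e)⁻¹ * y j := by
    simp [he, smul_dotProduct]
  rw [neg_dotProduct] at h2
  rw [h3] at h1 h2
  have h4 : (N e)⁻¹ * y j = 0 := by linarith
  rcases mul_eq_zero.mp h4 with h | h
  · exact absurd h (by positivity)
  · exact h

/-- The coordinate-`k` norm is the norm whose dual norm is the dual coordinate-`k` norm. -/
lemma dualNorm_coordNorm {d : ℕ} (N : Seminorm ℝ (Fin d → ℝ)) (hN : ∀ x, N x = 0 → x = 0)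
    {k : ℕ} (hk : 1 ≤ k) : dualNorm (coordNorm N k) = dualCoordNorm N k := by
  obtain ⟨p, hp, hp0⟩ := exists_dualCoordNorm_eq N hN hk
  rw [coordNorm, ← hp, dualNorm_dualNorm p hp0]

end

end Capra

open Capra

/-!
The argument compares support functions. For a fixed `y`, the Capra conjugate of `φ ∘ ℓ₀` is a
supremum of `⟨x / ‖x‖, y⟩ - φ (ℓ₀ x)`; grouping the vectors by the value `l` of `ℓ₀` leaves the
supremum of `⟨·, y⟩` over the normalized vectors with exactly `l` nonzero components. As these
vectors are dense in the part of the unit sphere made of the vectors with at most `l` nonzero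
components, this is the dual coordinate norm `‖y‖⋆_(l)` (`isLUB_normalized_ell0`). The unit ball
and the unit sphere of the coordinate-`l` norm have the same support function (`isLUB_coordBall`,
`isLUB_coordSphere`), so that `φ ∘ ℓ₀` and the functions built from balls and from spheres all have
the conjugate `sup_l (‖·‖⋆_(l) - φ l)` (`coupConj_capra`, `coupConj_infOver`). That a Fenchel
biconjugate is the largest closed convex minorant is the Fenchel–Moreau theorem
(`isGreatest_coupBiconj`), which rests on the separation of a point from a closed convex epigraph.

For a finite valued `φ`, consider the pairs of a weight `t` in the simplex and of vectors `z l` of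
coordinate-`l` norm at most `t l`. They form a compact convex set, hence so do the pairs
`(∑ z l, ∑ t l * φ l)`, and the lower envelope of the latter set is a closed convex function with
attained values. It lies below the function built from balls, hence below the largest closed convex
minorant `capraFenchel N φ`; Jensen's inequality gives the reverse comparison
(`capraFenchel_eq_lowerEnvelope`). The other minimization formulas follow by turning a feasible
point of one problem into a feasible point of another one without increasing the cost: when `φ` is
nonnegative and `φ 0 = 0`, weights may be lowered to the norms of the vectors.
-/

namespace Capra

/-! ### Extended real arithmetic -/

/-- For a real number `a`, lower addition satisfies `a - b ≤ c → a - c ≤ b` without any condition on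
`b` and `c`. -/
lemma coe_add_neg_le_comm {a : ℝ} {b c : EReal} (h : (a : EReal) + -b ≤ c) :
    (a : EReal) + -c ≤ b := by
  induction b with
  | top => exact le_top
  | bot =>
    have : c = ⊤ := by simpa using h
    simp [this]
  | coe b =>
    induction c with
    | top => simp
    | bot =>
      exfalso
      rw [← EReal.coe_neg, ← EReal.coe_add] at h
      exact EReal.coe_ne_bot _ (le_bot_iff.mp h)
    | coe c =>
      norm_cast at h ⊢
      linarith

/-- Subtracting an extended real commutes with the supremum of a nonempty bounded set of reals. -/
lemma isLUB_add_neg_le {S : Set ℝ} {s : ℝ} (hs : IsLUB S s) {a b : EReal}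
    (h : ∀ r ∈ S, (r : EReal) + -a ≤ b) : (s : EReal) + -a ≤ b := by
  obtain ⟨r₀, hr₀⟩ := hs.nonempty
  induction a with
  | top => simp
  | bot => simpa using h r₀ hr₀
  | coe a =>
    induction b with
    | top => exact le_top
    | bot =>
      exfalso
      have := h r₀ hr₀
      rw [← EReal.coe_neg, ← EReal.coe_add] at this
      exact EReal.coe_ne_bot _ (le_bot_iff.mp this)
    | coe b =>
      norm_cast at h ⊢
      have : s ≤ b + a := hs.2 fun r hr => by linarith [h r hr]
      linarith

/-! ### Conjugates of functions that depend on finitely many levels -/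

lemma upAdd_zero_left (a : EReal) : upAdd 0 a = a := by simp [upAdd]

lemma upAdd_top_left (a : EReal) : upAdd ⊤ a = ⊤ := by simp [upAdd]

lemma infChar_eq_infOver {d : ℕ} (B : ℕ → Set (Fin d → ℝ)) (φ : Fin (d + 1) → EReal) :
    infChar B φ = infOver B φ := by
  funext x
  refine le_antisymm (le_sInf ?_) (le_iInf fun l => ?_)
  · rintro a ⟨l, hl, rfl⟩
    refine iInf_le_of_le l ?_
    rw [charFn, if_pos hl, upAdd_zero_left]
  · by_cases hl : x ∈ B l
    · rw [charFn, if_pos hl, upAdd_zero_left]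
      exact sInf_le ⟨l, hl, rfl⟩
    · rw [charFn, if_neg hl, upAdd_top_left]
      exact le_top

lemma infOver_le {d : ℕ} {B : ℕ → Set (Fin d → ℝ)} {φ : Fin (d + 1) → EReal}
    {l : Fin (d + 1)} {x : Fin d → ℝ} (hx : x ∈ B l) : infOver B φ x ≤ φ l :=
  sInf_le ⟨l, hx, rfl⟩

/-- The Fenchel conjugate of `infOver B φ` only depends on the support functions of the sets
`B l`. -/
lemma coupConj_infOver {d : ℕ} {B : ℕ → Set (Fin d → ℝ)} {D : ℕ → (Fin d → ℝ) → ℝ}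
    (hB : ∀ l ≤ d, ∀ y, IsLUB ((· ⬝ᵥ y) '' B l) (D l y)) (φ : Fin (d + 1) → EReal) :
    coupConj fenchel (infOver B φ) = fun y => ⨆ l : Fin (d + 1), (D l y : EReal) - φ l := by
  funext y
  refine le_antisymm (iSup_le fun x => coe_add_neg_le_comm (le_sInf ?_)) (iSup_le fun l => ?_)
  · rintro a ⟨l, hl, rfl⟩
    refine coe_add_neg_le_comm (le_iSup_of_le l ?_)
    rw [sub_eq_add_neg]
    gcongr
    exact (hB l l.is_le y).1 ⟨x, hl, rfl⟩
  · rw [sub_eq_add_neg]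
    refine isLUB_add_neg_le (hB l l.is_le y) ?_
    rintro _ ⟨x, hx, rfl⟩
    refine le_iSup_of_le x ?_
    rw [fenchel]
    gcongr
    exact EReal.neg_le_neg_iff.mpr (infOver_le hx)

lemma capra_eq_fenchel {d : ℕ} (N : (Fin d → ℝ) → ℝ) (x y : Fin d → ℝ) :
    capra N x y = fenchel ((N x)⁻¹ • x) y := by
  by_cases hx : x = 0
  · simp [capra, fenchel, hx]
  · simp [capra, fenchel, hx, smul_dotProduct, div_eq_inv_mul]

/-- The Capra conjugate of `φ ∘ ell0` only depends on the support functions of the sets of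
normalized vectors with a given number of nonzero components. -/
lemma coupConj_capra {d : ℕ} {N : (Fin d → ℝ) → ℝ} {D : ℕ → (Fin d → ℝ) → ℝ}
    (hD : ∀ (l : Fin (d + 1)) (y),
      IsLUB ((fun x => ((N x)⁻¹ • x) ⬝ᵥ y) '' {x | ell0 x = l}) (D l y))
    (φ : Fin (d + 1) → EReal) :
    coupConj (capra N) (φ ∘ ell0) = fun y => ⨆ l : Fin (d + 1), (D l y : EReal) - φ l := by
  funext y
  refine le_antisymm (iSup_le fun x => le_iSup_of_le (ell0 x) ?_) (iSup_le fun l => ?_)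
  · rw [sub_eq_add_neg, capra_eq_fenchel, fenchel, Function.comp_apply]
    gcongr
    exact (hD (ell0 x) y).1 ⟨x, rfl, rfl⟩
  · rw [sub_eq_add_neg]
    refine isLUB_add_neg_le (hD l y) ?_
    rintro _ ⟨x, rfl, rfl⟩
    refine le_iSup_of_le x ?_
    rw [capra_eq_fenchel, fenchel, Function.comp_apply]

/-! ### The Fenchel–Moreau theorem -/

lemma isClosedConvexFn_coupConjRev {d : ℕ} (g : (Fin d → ℝ) → EReal) :
    IsClosedConvexFn (coupConjRev fenchel g) := by
  have hepi : epigraph (coupConjRev fenchel g)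
      = ⋂ y, {p : (Fin d → ℝ) × ℝ | ((p.1 ⬝ᵥ y : ℝ) : EReal) + -g y ≤ (p.2 : EReal)} := by
    ext p
    simp [epigraph, coupConjRev, coupConj, fenchel]
  have key : ∀ y, Convex ℝ {p : (Fin d → ℝ) × ℝ | ((p.1 ⬝ᵥ y : ℝ) : EReal) + -g y ≤ (p.2 : EReal)}
      ∧ IsClosed {p : (Fin d → ℝ) × ℝ | ((p.1 ⬝ᵥ y : ℝ) : EReal) + -g y ≤ (p.2 : EReal)} := by
    intro y
    induction g y with
    | top => simp [convex_univ]
    | bot => simp [convex_empty]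
    | coe c =>
      have : {p : (Fin d → ℝ) × ℝ | ((p.1 ⬝ᵥ y : ℝ) : EReal) + -(c : EReal) ≤ (p.2 : EReal)}
          = {p : (Fin d → ℝ) × ℝ | p.1 ⬝ᵥ y - p.2 ≤ c} := by
        ext p
        simp only [Set.mem_ofPred_eq]
        norm_cast
        constructor <;> intro h <;> linarith
      rw [this]
      constructor
      · refine convex_halfSpace_le ⟨fun p q => ?_, fun a p => ?_⟩ c
        · simp only [Prod.fst_add, Prod.snd_add, add_dotProduct]; ring
        · simp only [Prod.smul_fst, Prod.smul_snd, smul_dotProduct, smul_eq_mul]; ring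
      · refine isClosed_le ?_ continuous_const
        simp only [dotProduct]
        fun_prop
  refine ⟨?_, ?_⟩
  · rw [IsConvexFn, hepi]
    exact convex_iInter fun y => (key y).1
  · by_cases h : ∀ y, g y = ⊤
    · right
      intro x
      simp [coupConjRev, coupConj, h]
    · left
      push Not at h
      obtain ⟨y, hy⟩ := h
      refine ⟨?_, fun x => ?_⟩
      · rw [IsLscFn, hepi]
        exact isClosed_iInter fun y => (key y).2
      · refine ne_bot_of_le_ne_bot ?_ (le_iSup (fun y => fenchel x y + -g y) y)
        simp [fenchel, EReal.add_eq_bot_iff, hy]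

/-- Strict separation of a point below the graph from the epigraph. The coefficient `β` of the
vertical coordinate vanishes when the separating hyperplane is vertical. -/
lemma exists_separation {d : ℕ} {g : (Fin d → ℝ) → EReal} (hc : IsConvexFn g) (hl : IsLscFn g)
    {x : Fin d → ℝ} {r : ℝ} (h : (r : EReal) < g x) :
    ∃ (a : Fin d → ℝ) (β u : ℝ), x ⬝ᵥ a + r * β < u ∧
      ∀ (z : Fin d → ℝ) (s : ℝ), g z ≤ (s : EReal) → u < z ⬝ᵥ a + s * β := by
  obtain ⟨L, u, h1, h2⟩ := geometric_hahn_banach_point_closed (x := (x, r)) hc hl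
    (fun hmem => absurd h (not_lt.mpr hmem))
  set f : (Fin d → ℝ) →ₗ[ℝ] ℝ := L.toLinearMap ∘ₗ LinearMap.inl ℝ (Fin d → ℝ) ℝ with hf
  have hL : ∀ z s, L (z, s) = z ⬝ᵥ (dotProductEquiv ℝ (Fin d)).symm f + s * L (0, 1) := by
    intro z s
    have h3 : (dotProductEquiv ℝ (Fin d)).symm f ⬝ᵥ z = f z := by
      have : (dotProductEquiv ℝ (Fin d)) ((dotProductEquiv ℝ (Fin d)).symm f) = f := by simp
      exact congrArg (fun k : (Fin d → ℝ) →ₗ[ℝ] ℝ => k z) this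
    have h4 : (z, s) = (z, (0 : ℝ)) + s • ((0 : Fin d → ℝ), (1 : ℝ)) := by simp
    rw [dotProduct_comm, h3, h4, map_add, map_smul, smul_eq_mul]
    rfl
  refine ⟨_, L (0, 1), u, by rw [← hL]; exact h1, fun z s hz => ?_⟩
  rw [← hL]
  exact h2 (z, s) hz

lemma affine_minorant_of_separation {d : ℕ} {g : (Fin d → ℝ) → EReal} (hb : ∀ x, g x ≠ ⊥)
    {a : Fin d → ℝ} {β u : ℝ} (hβ : 0 < β)
    (h : ∀ (z : Fin d → ℝ) (s : ℝ), g z ≤ (s : EReal) → u < z ⬝ᵥ a + s * β) (z : Fin d → ℝ) :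
    ((z ⬝ᵥ (-β⁻¹ • a) - -(u / β) : ℝ) : EReal) ≤ g z := by
  rcases eq_or_ne (g z) ⊤ with ht | ht
  · rw [ht]; exact le_top
  lift g z to ℝ using ⟨ht, hb z⟩ with s hs
  have h1 := h z s hs.ge
  rw [EReal.coe_le_coe_iff, dotProduct_smul, smul_eq_mul]
  have : -β⁻¹ * z ⬝ᵥ a - -(u / β) = (u - z ⬝ᵥ a) / β := by field_simp; ring
  rw [this, div_le_iff₀ hβ]
  linarith

/-- A closed convex function that is nowhere `-∞` is the supremum of its affine minorants. -/
lemma exists_affine_minorant {d : ℕ} {g : (Fin d → ℝ) → EReal} (hc : IsConvexFn g)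
    (hl : IsLscFn g) (hb : ∀ x, g x ≠ ⊥) {x : Fin d → ℝ} {r : ℝ} (h : (r : EReal) < g x) :
    ∃ (y : Fin d → ℝ) (c : ℝ), (∀ z, ((z ⬝ᵥ y - c : ℝ) : EReal) ≤ g z) ∧ r < x ⬝ᵥ y - c := by
  by_cases htop : ∀ z, g z = ⊤
  · exact ⟨0, -(r + 1), fun z => by rw [htop z]; exact le_top, by simp⟩
  push Not at htop
  obtain ⟨x₁, hx₁⟩ := htop
  obtain ⟨s₁, hs₁⟩ : ∃ s : ℝ, (s : EReal) = g x₁ := ⟨_, EReal.coe_toReal hx₁ (hb x₁)⟩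
  obtain ⟨a, β, u, h1, h2⟩ := exists_separation hc hl h
  -- a point of the epigraph can be moved upwards, which makes `β` nonnegative
  have hβ : 0 ≤ β := by
    by_contra hneg
    push Not at hneg
    set s : ℝ := max s₁ ((u - x₁ ⬝ᵥ a) / β) with hs
    have h3 := h2 x₁ s (by rw [← hs₁]; exact_mod_cast le_max_left _ _)
    have h4 : (u - x₁ ⬝ᵥ a) / β ≤ s := le_max_right _ _
    rw [div_le_iff_of_neg hneg] at h4
    linarith
  rcases hβ.eq_or_lt with h0 | hpos
  · -- vertical hyperplane: add a large multiple of it to an affine minorant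
    -- (at a point where `g` is finite, no separating hyperplane is vertical)
    obtain ⟨a', β', u', h1', h2'⟩ := exists_separation (x := x₁) (r := s₁ - 1) hc hl
      (by rw [← hs₁]; exact_mod_cast sub_one_lt s₁)
    have hβ' : 0 < β' := by linarith [h2' x₁ s₁ hs₁.ge]
    have hmin := affine_minorant_of_separation hb hβ' h2'
    set y' := -β'⁻¹ • a'
    set c' := -(u' / β')
    have hux : 0 < u - x ⬝ᵥ a := by rw [← h0] at h1; linarith
    set k : ℝ := (|r - (x ⬝ᵥ y' - c')| + 1) / (u - x ⬝ᵥ a) with hk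
    have hk0 : 0 ≤ k := by positivity
    refine ⟨y' - k • a, c' - k * u, fun z => ?_, ?_⟩
    · rcases eq_or_ne (g z) ⊤ with ht | ht
      · rw [ht]; exact le_top
      refine le_trans ?_ (hmin z)
      have h3 := h2 z (g z).toReal (EReal.coe_toReal ht (hb z)).ge
      rw [← h0, mul_zero, add_zero] at h3
      rw [EReal.coe_le_coe_iff, dotProduct_sub, dotProduct_smul k z a, smul_eq_mul]
      nlinarith
    · have h3 : k * (u - x ⬝ᵥ a) = |r - (x ⬝ᵥ y' - c')| + 1 := by
        rw [hk, div_mul_cancel₀ _ hux.ne']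
      rw [dotProduct_sub, dotProduct_smul k x a, smul_eq_mul]
      have := le_abs_self (r - (x ⬝ᵥ y' - c'))
      nlinarith
  · refine ⟨-β⁻¹ • a, -(u / β), affine_minorant_of_separation hb hpos h2, ?_⟩
    rw [dotProduct_smul, smul_eq_mul]
    have : -β⁻¹ * x ⬝ᵥ a - -(u / β) = (u - x ⬝ᵥ a) / β := by field_simp; ring
    rw [this, lt_div_iff₀ hpos]
    linarith

lemma coupBiconj_fenchel_le {d : ℕ} (h : (Fin d → ℝ) → EReal) : coupBiconj fenchel h ≤ h :=
  fun x => iSup_le fun y => coe_add_neg_le_comm (le_iSup (fun x => fenchel x y + -h x) x)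

/-- The nontrivial half of the Fenchel–Moreau theorem. -/
lemma IsClosedConvexFn.le_coupBiconj {d : ℕ} {g h : (Fin d → ℝ) → EReal}
    (hg : IsClosedConvexFn g) (hgh : g ≤ h) : g ≤ coupBiconj fenchel h := by
  obtain ⟨hc, ⟨hl, hb⟩ | hbot⟩ := hg
  · intro x
    refine EReal.ge_of_forall_gt_iff_ge.mp fun r hr => ?_
    obtain ⟨y, c, hmin, hrc⟩ := exists_affine_minorant hc hl hb hr
    have hconj : coupConj fenchel h y ≤ c := by
      refine iSup_le fun z => coe_add_neg_le_comm ?_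
      have := (hmin z).trans (hgh z)
      rwa [sub_eq_add_neg, EReal.coe_add, EReal.coe_neg] at this
    refine le_trans ?_ (le_iSup (fun y => fenchel x y + -coupConj fenchel h y) y)
    calc (r : EReal) ≤ ((x ⬝ᵥ y - c : ℝ) : EReal) := by exact_mod_cast hrc.le
      _ = fenchel x y + -(c : EReal) := by
        rw [sub_eq_add_neg, EReal.coe_add, EReal.coe_neg, fenchel]
      _ ≤ _ := by
        gcongr
        exact EReal.neg_le_neg_iff.mpr hconj
  · intro x
    rw [hbot x]
    exact bot_le

/-- The biconjugate is the largest closed convex minorant. -/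
lemma isGreatest_coupBiconj {d : ℕ} (h : (Fin d → ℝ) → EReal) :
    IsGreatest {g | IsClosedConvexFn g ∧ g ≤ h} (coupBiconj fenchel h) :=
  ⟨⟨isClosedConvexFn_coupConjRev _, coupBiconj_fenchel_le h⟩,
    fun _ hg => hg.1.le_coupBiconj hg.2⟩

/-! ### Support functions of the coordinate balls, of the spheres and of the level sets of ℓ₀ -/

lemma isLUB_supp {d : ℕ} {S : Set (Fin d → ℝ)} {C : ℝ} (hC : ∀ x ∈ S, ‖x‖ ≤ C) (h0 : 0 ∈ S)
    (y : Fin d → ℝ) : IsLUB ((· ⬝ᵥ y) '' S) (supp S y) := by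
  refine ⟨?_, fun b hb => supp_le h0 fun x hx => hb ⟨x, hx, rfl⟩⟩
  rintro _ ⟨x, hx, rfl⟩
  exact le_supp hC hx y

lemma continuous_seminorm {d : ℕ} (p : Seminorm ℝ (Fin d → ℝ)) : Continuous p :=
  continuousOn_univ.mp (p.convexOn.continuousOn isOpen_univ)

/-- The support function of the unit sphere of a norm is that of its unit ball. -/
lemma isLUB_sphere_of_ball {d : ℕ} (hd : 1 ≤ d) (p : Seminorm ℝ (Fin d → ℝ))
    (hp : ∀ x, p x = 0 → x = 0) {y : Fin d → ℝ} {s : ℝ}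
    (h : IsLUB ((· ⬝ᵥ y) '' {x | p x ≤ 1}) s) : IsLUB ((· ⬝ᵥ y) '' {x | p x = 1}) s := by
  have hnorm : ∀ x : Fin d → ℝ, x ≠ 0 → p ((p x)⁻¹ • x) = 1 := fun x hx => by
    have : p x ≠ 0 := fun h => hx (hp x h)
    rw [map_smul_eq_mul, Real.norm_of_nonneg (by positivity), inv_mul_cancel₀ this]
  refine ⟨fun r hr => h.1 (Set.image_mono (fun x hx => le_of_eq hx) hr), fun b hb => h.2 ?_⟩
  have hb' : ∀ x, p x = 1 → x ⬝ᵥ y ≤ b := fun x hx => hb ⟨x, hx, rfl⟩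
  -- the sphere is nonempty and symmetric
  have hb0 : 0 ≤ b := by
    have he : (Pi.single ⟨0, hd⟩ 1 : Fin d → ℝ) ≠ 0 := by simp
    have h1 := hb' _ (hnorm _ he)
    have h2 := hb' (-((p (Pi.single ⟨0, hd⟩ 1))⁻¹ • Pi.single ⟨0, hd⟩ 1))
      (by rw [map_neg_eq_map]; exact hnorm _ he)
    rw [neg_dotProduct] at h2
    linarith
  rintro _ ⟨x, hx, rfl⟩
  by_cases hx0 : x = 0
  · simpa [hx0] using hb0
  have hpos : 0 < p x := lt_of_le_of_ne (apply_nonneg p x) fun h => hx0 (hp x h.symm)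
  have h1 := hb' _ (hnorm x hx0)
  rw [smul_dotProduct, smul_eq_mul, ← div_eq_inv_mul, div_le_iff₀ hpos] at h1
  have hx' : p x ≤ 1 := hx
  change x ⬝ᵥ y ≤ b
  nlinarith

/-- The vectors of the unit ball of `N` with at most `k` nonzero components. -/
def sparseBall {d : ℕ} (N : (Fin d → ℝ) → ℝ) (k : ℕ) : Set (Fin d → ℝ) :=
  {x | (ell0 x : ℕ) ≤ k ∧ N x ≤ 1}

lemma ell0_le_card {d : ℕ} {K : Finset (Fin d)} {x : Fin d → ℝ} (hx : x ∈ flat K) :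
    (ell0 x : ℕ) ≤ K.card := by
  change (Finset.univ.filter (fun j => x j ≠ 0)).card ≤ K.card
  refine Finset.card_le_card fun j hj => ?_
  by_contra h
  exact (Finset.mem_filter.mp hj).2 (hx j h)

lemma ell0_zero {d : ℕ} : ell0 (0 : Fin d → ℝ) = 0 := by
  ext
  simp [ell0]

lemma ell0_smul {d : ℕ} {c : ℝ} (hc : c ≠ 0) (x : Fin d → ℝ) : ell0 (c • x) = ell0 x := by
  simp [ell0, hc]

lemma dotProduct_proj {d : ℕ} {K : Finset (Fin d)} {x : Fin d → ℝ} (hx : x ∈ flat K)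
    (y : Fin d → ℝ) : x ⬝ᵥ proj K y = x ⬝ᵥ y := by
  refine Finset.sum_congr rfl fun j _ => ?_
  by_cases hj : j ∈ K
  · simp [proj, hj]
  · simp [hx j hj]

lemma zero_mem_sparseBall {d : ℕ} (N : Seminorm ℝ (Fin d → ℝ)) (k : ℕ) :
    0 ∈ sparseBall N k := by
  simp [sparseBall, ell0_zero]

lemma dualCoordNorm_eq_supp {d : ℕ} (N : Seminorm ℝ (Fin d → ℝ)) (hN : ∀ x, N x = 0 → x = 0)
    (k : ℕ) : dualCoordNorm N k = supp (sparseBall N k) := by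
  obtain ⟨C, hC⟩ := exists_bound N hN
  have hb : ∀ x ∈ sparseBall N k, ‖x‖ ≤ C := fun x hx => hC x hx.2
  funext y
  have hinner : ∀ K : Finset (Fin d), K.card ≤ k →
      dualNormOn (flat K) N (proj K y) ≤ supp (sparseBall N k) y := by
    intro K hK
    refine csSup_le ⟨_, 0, Submodule.zero_mem _, by simp, rfl⟩ ?_
    rintro r ⟨x, hx, hx1, rfl⟩
    rw [dotProduct_proj hx]
    exact le_supp hb ⟨(ell0_le_card hx).trans hK, hx1⟩ y
  refine le_antisymm (csSup_le ⟨_, ∅, by simp, rfl⟩ ?_)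
    (supp_le (zero_mem_sparseBall N k) ?_)
  · rintro r ⟨K, hK, rfl⟩
    exact hinner K hK
  · rintro x ⟨hxk, hx1⟩
    set K := Finset.univ.filter (fun j => x j ≠ 0) with hK
    have hx : x ∈ flat K := fun j hj => by simpa [hK] using hj
    have h1 : x ⬝ᵥ y ≤ dualNormOn (flat K) N (proj K y) := by
      rw [← dotProduct_proj hx]
      refine le_csSup ((supp_bddAbove (S := {x | N x ≤ 1}) hC (proj K y)).mono ?_)
        ⟨x, hx, hx1, rfl⟩
      rintro r ⟨x', -, hx1', rfl⟩
      exact ⟨x', hx1', rfl⟩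
    refine h1.trans (le_csSup ⟨supp (sparseBall N k) y, ?_⟩ ⟨K, hxk, rfl⟩)
    rintro r ⟨K', hK', rfl⟩
    exact hinner K' hK'

/-- A bound that is homogeneous and holds for the vectors with exactly `k` nonzero components also
holds, by density, for the vectors with fewer nonzero components. -/
lemma dotProduct_le_of_forall_ell0_eq {d : ℕ} (N : Seminorm ℝ (Fin d → ℝ)) {l : Fin (d + 1)}
    {b : ℝ} {y : Fin d → ℝ} (h : ∀ x, ell0 x = l → x ⬝ᵥ y ≤ b * N x) {x : Fin d → ℝ}
    (hx : ell0 x ≤ l) : x ⬝ᵥ y ≤ b * N x := by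
  obtain ⟨K, hxK, -, hK⟩ := Finset.exists_subsuperset_card_eq
    (Finset.subset_univ (Finset.univ.filter (fun j => x j ≠ 0))) (n := (l : ℕ)) hx
    (by simpa using l.is_le)
  -- for small `ε ≠ 0`, the support of `x + ε • e` is exactly `K`
  set e : Fin d → ℝ := fun j => if j ∈ K then 1 else 0 with he
  have hev : ∀ᶠ ε : ℝ in nhdsWithin 0 {0}ᶜ, ell0 (x + ε • e) = l := by
    have h1 : ∀ᶠ ε : ℝ in nhdsWithin 0 {0}ᶜ, ∀ j, x j ≠ 0 → x j + ε ≠ 0 := by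
      refine Filter.eventually_all.mpr fun j => ?_
      by_cases hj : x j = 0
      · simp [hj]
      have hc : ContinuousAt (fun ε : ℝ => x j + ε) 0 := by fun_prop
      filter_upwards [nhdsWithin_le_nhds (hc.eventually_ne (by simpa using hj))] with ε hε _
        using hε
    filter_upwards [h1, self_mem_nhdsWithin] with ε hε hε0
    ext
    rw [← hK]
    change (Finset.univ.filter (fun j => (x + ε • e) j ≠ 0)).card = K.card
    congr 1
    ext j
    by_cases hjK : j ∈ K
    · by_cases hj : x j = 0
      · simpa [he, hjK, hj] using hε0
      · simpa [he, hjK] using hε j hj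
    · have hj : x j = 0 := by
        by_contra hj
        exact hjK (hxK (by simpa using hj))
      simp [he, hjK, hj]
  have hN := continuous_seminorm N
  have hc1 : Filter.Tendsto (fun ε : ℝ => (x + ε • e) ⬝ᵥ y) (nhdsWithin 0 {0}ᶜ)
      (nhds (x ⬝ᵥ y)) := by
    have : Continuous fun ε : ℝ => (x + ε • e) ⬝ᵥ y := by
      simp only [dotProduct]; fun_prop
    simpa using (this.tendsto 0).mono_left nhdsWithin_le_nhds
  have hc2 : Filter.Tendsto (fun ε : ℝ => b * N (x + ε • e)) (nhdsWithin 0 {0}ᶜ)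
      (nhds (b * N x)) := by
    have : Continuous fun ε : ℝ => b * N (x + ε • e) := by fun_prop
    simpa using (this.tendsto 0).mono_left nhdsWithin_le_nhds
  exact le_of_tendsto_of_tendsto hc1 hc2 (hev.mono fun ε hε => h _ hε)

lemma isLUB_normalized_ell0 {d : ℕ} (N : Seminorm ℝ (Fin d → ℝ)) (hN : ∀ x, N x = 0 → x = 0)
    (l : Fin (d + 1)) (y : Fin d → ℝ) :
    IsLUB ((fun x => ((N x)⁻¹ • x) ⬝ᵥ y) '' {x | ell0 x = l}) (dualCoordNorm N l y) := by
  obtain ⟨C, hC⟩ := exists_bound N hN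
  rw [dualCoordNorm_eq_supp N hN]
  have hlub := isLUB_supp (fun x hx => hC x hx.2) (zero_mem_sparseBall N l) y
  refine ⟨?_, fun b hb => hlub.2 ?_⟩
  · rintro _ ⟨x, rfl, rfl⟩
    refine hlub.1 ⟨(N x)⁻¹ • x, ⟨?_, ?_⟩, rfl⟩
    · by_cases hx : x = 0
      · simp [hx]
      · rw [ell0_smul (inv_ne_zero fun h => hx (hN x h))]
    · rw [map_smul_eq_mul, Real.norm_of_nonneg (by positivity)]
      exact inv_mul_le_one
  have hb' : ∀ x, ell0 x = l → x ⬝ᵥ y ≤ b * N x := by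
    intro x hx
    by_cases hx0 : x = 0
    · simp [hx0]
    have hpos : 0 < N x := lt_of_le_of_ne (apply_nonneg N x) fun h => hx0 (hN x h.symm)
    have h1 : ((N x)⁻¹ • x) ⬝ᵥ y ≤ b := hb ⟨x, hx, rfl⟩
    rwa [smul_dotProduct, smul_eq_mul, ← div_eq_inv_mul, div_le_iff₀ hpos] at h1
  -- the level set is nonempty and symmetric
  have hb0 : 0 ≤ b := by
    obtain ⟨K, hK⟩ : ∃ K : Finset (Fin d), K.card = l := by
      obtain ⟨K, -, hK⟩ := Finset.exists_subset_card_eq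
        (s := (Finset.univ : Finset (Fin d))) (n := (l : ℕ)) (by simpa using l.is_le)
      exact ⟨K, hK⟩
    have he : ell0 (fun j => if j ∈ K then (1 : ℝ) else 0) = l := by
      ext
      simp [ell0, hK]
    have h1 : _ ≤ b := hb ⟨_, he, rfl⟩
    have h2 : _ ≤ b := hb ⟨-fun j => if j ∈ K then (1 : ℝ) else 0, ?_, rfl⟩
    · simp only [map_neg_eq_map, smul_neg, neg_dotProduct] at h1 h2
      linarith
    · rw [Set.mem_ofPred_eq, ← neg_one_smul ℝ, ell0_smul (by norm_num), he]
  rintro _ ⟨x, ⟨hxl, hx1⟩, rfl⟩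
  have h1 := dotProduct_le_of_forall_ell0_eq N hb' (x := x) hxl
  change x ⬝ᵥ y ≤ b
  nlinarith

/-- The dual norm of a norm is a norm. -/
lemma exists_dualNorm_eq {d : ℕ} (q : Seminorm ℝ (Fin d → ℝ)) (hq : ∀ x, q x = 0 → x = 0) :
    ∃ p : Seminorm ℝ (Fin d → ℝ), ⇑p = dualNorm q ∧ ∀ x, p x = 0 → x = 0 := by
  obtain ⟨C, hC⟩ := exists_bound q hq
  have hdual : dualNorm q = supp {x | q x ≤ 1} := by
    funext y
    simp [dualNorm, dualNormOn, supp]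
  rw [hdual]
  refine ⟨suppSeminorm {x | q x ≤ 1} (by simp) (fun x hx => ?_) ⟨C, hC⟩, rfl, fun y hy => ?_⟩
  · rw [Set.mem_ofPred_eq, map_neg_eq_map]
    exact hx
  · by_contra hy0
    have hpos : 0 < q y := lt_of_le_of_ne (apply_nonneg q y) fun h => hy0 (hq y h.symm)
    have hmem : (q y)⁻¹ • y ∈ {x | q x ≤ 1} := by
      rw [Set.mem_ofPred_eq, map_smul_eq_mul, Real.norm_of_nonneg (by positivity)]
      exact inv_mul_le_one
    have h1 := le_supp (S := {x | q x ≤ 1}) hC hmem y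
    have h2 : supp {x | q x ≤ 1} y = 0 := hy
    rw [h2, smul_dotProduct, smul_eq_mul, ← div_eq_inv_mul, div_le_iff₀ hpos, zero_mul] at h1
    have h3 : 0 ≤ y ⬝ᵥ y := Finset.sum_nonneg fun i _ => mul_self_nonneg (y i)
    exact hy0 (dotProduct_self_eq_zero.mp (le_antisymm h1 h3))

lemma exists_coordNorm_eq {d : ℕ} (N : Seminorm ℝ (Fin d → ℝ)) (hN : ∀ x, N x = 0 → x = 0)
    {k : ℕ} (hk : 1 ≤ k) :
    ∃ p : Seminorm ℝ (Fin d → ℝ), ⇑p = coordNorm N k ∧ ∀ x, p x = 0 → x = 0 := by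
  obtain ⟨q, hq, hq0⟩ := exists_dualCoordNorm_eq N hN hk
  obtain ⟨p, hp, hp0⟩ := exists_dualNorm_eq q hq0
  exact ⟨p, by rw [hp, hq, coordNorm], hp0⟩

lemma isLUB_coordBall {d : ℕ} (N : Seminorm ℝ (Fin d → ℝ)) (hN : ∀ x, N x = 0 → x = 0) (l : ℕ)
    (y : Fin d → ℝ) : IsLUB ((· ⬝ᵥ y) '' coordBall N l) (dualCoordNorm N l y) := by
  rcases Nat.eq_zero_or_pos l with rfl | hl
  · simp [coordBall, dualCoordNorm_zero]
  obtain ⟨p, hp, hp0⟩ := exists_coordNorm_eq N hN hl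
  obtain ⟨C, hC⟩ := exists_bound p hp0
  have h := isLUB_supp (S := {x | p x ≤ 1}) hC (by simp) y
  have hdual : dualCoordNorm N l y = supp {x | p x ≤ 1} y := by
    rw [← dualNorm_coordNorm N hN hl, ← hp]
    simp [dualNorm, dualNormOn, supp]
  rwa [coordBall, if_neg hl.ne', hdual, ← hp]

lemma isLUB_coordSphere {d : ℕ} (hd : 1 ≤ d) (N : Seminorm ℝ (Fin d → ℝ))
    (hN : ∀ x, N x = 0 → x = 0) (l : ℕ) (y : Fin d → ℝ) :
    IsLUB ((· ⬝ᵥ y) '' coordSphere N l) (dualCoordNorm N l y) := by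
  have h := isLUB_coordBall N hN l y
  rcases Nat.eq_zero_or_pos l with rfl | hl
  · simpa [coordBall, coordSphere] using h
  obtain ⟨p, hp, hp0⟩ := exists_coordNorm_eq N hN hl
  rw [coordBall, if_neg hl.ne', ← hp] at h
  rw [coordSphere, if_neg hl.ne', ← hp]
  exact isLUB_sphere_of_ball hd p hp0 h

lemma zero_mem_coordBall {d : ℕ} (N : Seminorm ℝ (Fin d → ℝ)) (hN : ∀ x, N x = 0 → x = 0)
    (l : ℕ) : 0 ∈ coordBall N l := by
  rcases Nat.eq_zero_or_pos l with rfl | hl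
  · simp [coordBall]
  obtain ⟨p, hp, -⟩ := exists_coordNorm_eq N hN hl
  rw [coordBall, if_neg hl.ne', ← hp]
  simp

/-- The dual coordinate norms increase, so that the coordinate norms decrease. -/
lemma coordBall_mono {d : ℕ} (N : Seminorm ℝ (Fin d → ℝ)) (hN : ∀ x, N x = 0 → x = 0) :
    Monotone (coordBall N) := by
  intro k l hkl
  rcases Nat.eq_zero_or_pos k with rfl | hk
  · simpa [coordBall] using zero_mem_coordBall N hN l
  have hl : 1 ≤ l := le_trans (Nat.succ_le_of_lt hk) hkl
  obtain ⟨C, hC⟩ := exists_bound N hN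
  have hmono : ∀ y, dualCoordNorm N k y ≤ dualCoordNorm N l y := by
    intro y
    rw [dualCoordNorm_eq_supp N hN, dualCoordNorm_eq_supp N hN]
    refine supp_le (zero_mem_sparseBall N k) fun x hx => ?_
    exact le_supp (S := sparseBall N l) (fun x hx => hC x hx.2) ⟨hx.1.trans hkl, hx.2⟩ y
  obtain ⟨qk, hqk, hqk0⟩ := exists_dualCoordNorm_eq N hN hk
  obtain ⟨Ck, hCk⟩ := exists_bound qk hqk0
  intro x hx
  rw [coordBall, if_neg (by omega)] at hx ⊢
  change coordNorm N k x ≤ 1 at hx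
  change coordNorm N l x ≤ 1
  refine le_trans ?_ hx
  have hb := supp_bddAbove (S := {x | qk x ≤ 1}) hCk x
  refine csSup_le_csSup (hb.mono ?_) ⟨_, 0, trivial, ?_, rfl⟩ ?_
  · rintro r ⟨z, -, hz, rfl⟩
    exact ⟨z, by rwa [Set.mem_ofPred_eq, hqk], rfl⟩
  · obtain ⟨ql, hql, -⟩ := exists_dualCoordNorm_eq N hN hl
    rw [← hql]
    simp
  · rintro r ⟨z, -, hz, rfl⟩
    exact ⟨z, trivial, (hmono z).trans hz, rfl⟩

lemma coordNorm_eq_self {d : ℕ} (N : Seminorm ℝ (Fin d → ℝ))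
    (hN : ∀ x, N x = 0 → x = 0) : coordNorm N d = N := by
  have h : dualCoordNorm N d = dualNorm N := by
    rw [dualCoordNorm_eq_supp N hN]
    funext y
    have : sparseBall N d = {x | N x ≤ 1} := by
      ext x
      simp [sparseBall, (ell0 x).is_le]
    simp [dualNorm, dualNormOn, supp, this]
  rw [coordNorm, h, dualNorm_dualNorm N hN]

/-! ### Minima and lower envelopes of compact convex sets -/

lemma IsMinOver.of_forall_exists_le {ι κ : Type*} {S : Set ι} {T : Set κ} {f : ι → ℝ} {g : κ → ℝ}
    {v : EReal} (h : IsMinOver S f v) (hST : ∀ i ∈ S, ∃ j ∈ T, g j ≤ f i)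
    (hTS : ∀ j ∈ T, ∃ i ∈ S, f i ≤ g j) : IsMinOver T g v := by
  refine ⟨fun ⟨j, hj⟩ => ?_, fun hT => h.2 ?_⟩
  · obtain ⟨i, hi, -⟩ := hTS j hj
    obtain ⟨⟨i₀, hi₀, hv⟩, hlow⟩ := h.1 ⟨i, hi⟩
    have hlow' : ∀ j ∈ T, v ≤ g j := by
      intro j hj
      obtain ⟨i, hi, hij⟩ := hTS j hj
      exact (hlow ⟨i, hi, rfl⟩).trans (EReal.coe_le_coe_iff.mpr hij)
    refine ⟨?_, ?_⟩
    · obtain ⟨j₀, hj₀, hji⟩ := hST i₀ hi₀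
      refine ⟨j₀, hj₀, le_antisymm ?_ (hlow' j₀ hj₀)⟩
      rw [← hv]
      exact EReal.coe_le_coe_iff.mpr hji
    · rintro _ ⟨j, hj, rfl⟩
      exact hlow' j hj
  · rw [Set.eq_empty_iff_forall_notMem]
    intro i hi
    obtain ⟨j, hj, -⟩ := hST i hi
    rw [hT] at hj
    exact hj

/-- The function whose value at `x` is the infimum of the fibre of `P` over `x`, and `+∞`
if this fibre is empty. -/
noncomputable def lowerEnvelope {d : ℕ} (P : Set ((Fin d → ℝ) × ℝ)) (x : Fin d → ℝ) : EReal :=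
  sInf ((fun r : ℝ => (r : EReal)) '' {r | (x, r) ∈ P})

lemma lowerEnvelope_le {d : ℕ} {P : Set ((Fin d → ℝ) × ℝ)} {x : Fin d → ℝ} {r : ℝ}
    (h : (x, r) ∈ P) : lowerEnvelope P x ≤ r :=
  sInf_le ⟨r, h, rfl⟩

lemma exists_lowerEnvelope_eq {d : ℕ} {P : Set ((Fin d → ℝ) × ℝ)} (hP : IsCompact P)
    {x : Fin d → ℝ} (hx : {r | (x, r) ∈ P}.Nonempty) :
    ∃ m : ℝ, (x, m) ∈ P ∧ lowerEnvelope P x = m := by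
  have hc : IsCompact {r | (x, r) ∈ P} :=
    (hP.image continuous_snd).of_isClosed_subset (hP.isClosed.preimage (Continuous.prodMk_right x))
      fun r hr => ⟨(x, r), hr, rfl⟩
  obtain ⟨m, hm, hlow⟩ := hc.exists_isLeast hx
  refine ⟨m, hm, le_antisymm (lowerEnvelope_le hm) (le_sInf ?_)⟩
  rintro _ ⟨r, hr, rfl⟩
  exact EReal.coe_le_coe_iff.mpr (hlow hr)

lemma lowerEnvelope_eq_top {d : ℕ} {P : Set ((Fin d → ℝ) × ℝ)} {x : Fin d → ℝ}
    (hx : {r | (x, r) ∈ P} = ∅) : lowerEnvelope P x = ⊤ := by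
  rw [lowerEnvelope, hx, Set.image_empty, sInf_empty]

lemma lowerEnvelope_ne_bot {d : ℕ} {P : Set ((Fin d → ℝ) × ℝ)} (hP : IsCompact P)
    (x : Fin d → ℝ) : lowerEnvelope P x ≠ ⊥ := by
  rcases Set.eq_empty_or_nonempty {r | (x, r) ∈ P} with hx | hx
  · rw [lowerEnvelope_eq_top hx]
    exact top_ne_bot
  · obtain ⟨m, -, hm⟩ := exists_lowerEnvelope_eq hP hx
    rw [hm]
    exact EReal.coe_ne_bot m

lemma epigraph_lowerEnvelope {d : ℕ} {P : Set ((Fin d → ℝ) × ℝ)} (hP : IsCompact P) :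
    epigraph (lowerEnvelope P) = P + ({0} : Set (Fin d → ℝ)) ×ˢ Set.Ici (0 : ℝ) := by
  ext ⟨x, r⟩
  rw [Set.mem_add]
  constructor
  · intro h
    have h' : lowerEnvelope P x ≤ (r : EReal) := h
    rcases Set.eq_empty_or_nonempty {r | (x, r) ∈ P} with hx | hx
    · rw [lowerEnvelope_eq_top hx, top_le_iff] at h'
      exact absurd h' (EReal.coe_ne_top r)
    · obtain ⟨m, hm, hmx⟩ := exists_lowerEnvelope_eq hP hx
      rw [hmx, EReal.coe_le_coe_iff] at h'
      exact ⟨(x, m), hm, (0, r - m), by simpa using h', by simp⟩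
  · rintro ⟨⟨x', m⟩, hm, ⟨w, s⟩, ⟨hw, hs⟩, heq⟩
    obtain rfl : w = 0 := hw
    obtain ⟨rfl, rfl⟩ := Prod.mk.inj heq
    have hs' : 0 ≤ s := hs
    change lowerEnvelope P (x' + 0) ≤ _
    rw [add_zero]
    exact (lowerEnvelope_le hm).trans (by exact_mod_cast le_add_of_nonneg_right hs')

lemma isClosedConvexFn_lowerEnvelope {d : ℕ} {P : Set ((Fin d → ℝ) × ℝ)} (hP : IsCompact P)
    (hPc : Convex ℝ P) : IsClosedConvexFn (lowerEnvelope P) := by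
  refine ⟨?_, Or.inl ⟨?_, lowerEnvelope_ne_bot hP⟩⟩
  · rw [IsConvexFn, epigraph_lowerEnvelope hP]
    exact hPc.add ((convex_singleton 0).prod (convex_Ici 0))
  · rw [IsLscFn, epigraph_lowerEnvelope hP]
    exact (isClosed_singleton.prod isClosed_Ici).add_left_of_isCompact hP

lemma isMinOver_lowerEnvelope {d : ℕ} {P : Set ((Fin d → ℝ) × ℝ)} (hP : IsCompact P)
    {ι : Type*} {S : Set ι} {f : ι → ℝ} {x : Fin d → ℝ} (h : f '' S = {r | (x, r) ∈ P}) :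
    IsMinOver S f (lowerEnvelope P x) := by
  refine ⟨fun hS => ?_, fun hS => lowerEnvelope_eq_top (by rw [← h, hS, Set.image_empty])⟩
  obtain ⟨m, hm, hmx⟩ := exists_lowerEnvelope_eq hP (h ▸ hS.image f)
  have hm' : m ∈ f '' S := h ▸ hm
  obtain ⟨i, hi, rfl⟩ := hm'
  refine ⟨⟨i, hi, hmx.symm⟩, ?_⟩
  rintro _ ⟨j, hj, rfl⟩
  refine lowerEnvelope_le ?_
  have : f j ∈ {r | (x, r) ∈ P} := h ▸ Set.mem_image_of_mem f hj
  exact this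

/-! ### Weighted decompositions along the coordinate norms -/

/-- The pairs of a weight `t` in the simplex and of a family of vectors `z` such that the
coordinate-`(l + 1)` norm of `z l` is at most `t (l + 1)`. -/
def weightedDecomp {d : ℕ} (N : (Fin d → ℝ) → ℝ) : Set ((Fin (d + 1) → ℝ) × (Fin d → Fin d → ℝ)) :=
  {q | q.1 ∈ stdSimplex ℝ (Fin (d + 1)) ∧ ∀ l : Fin d, coordNorm N (l + 1) (q.2 l) ≤ q.1 l.succ}

/-- The map that sends weighted vectors to their sum and their cost. -/
noncomputable def sumCost {d : ℕ} (φ : Fin (d + 1) → ℝ) :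
    ((Fin (d + 1) → ℝ) × (Fin d → Fin d → ℝ)) →ₗ[ℝ] (Fin d → ℝ) × ℝ where
  toFun q := (∑ l, q.2 l, ∑ l, q.1 l * φ l)
  map_add' p q := by simp [Finset.sum_add_distrib, add_mul]
  map_smul' c q := by simp [Finset.smul_sum, Finset.mul_sum, mul_assoc]

lemma exists_coordNorm_family {d : ℕ} (N : Seminorm ℝ (Fin d → ℝ))
    (hN : ∀ x, N x = 0 → x = 0) :
    ∃ p : Fin d → Seminorm ℝ (Fin d → ℝ),
      (∀ l : Fin d, coordNorm N (l + 1) = p l) ∧ ∀ l x, p l x = 0 → x = 0 := by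
  choose p hp hp0 using fun l : Fin d => exists_coordNorm_eq N hN (Nat.le_add_left 1 l)
  exact ⟨p, fun l => (hp l).symm, hp0⟩

lemma convex_weightedDecomp {d : ℕ} (N : Seminorm ℝ (Fin d → ℝ)) (hN : ∀ x, N x = 0 → x = 0) :
    Convex ℝ (weightedDecomp N) := by
  obtain ⟨p, hp, -⟩ := exists_coordNorm_family N hN
  intro q hq q' hq' a b ha hb hab
  refine ⟨convex_stdSimplex ℝ _ hq.1 hq'.1 ha hb hab, fun l => ?_⟩
  have h1 := hq.2 l
  have h2 := hq'.2 l
  rw [hp] at h1 h2 ⊢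
  calc p l (a • q.2 l + b • q'.2 l) ≤ a * p l (q.2 l) + b * p l (q'.2 l) := by
        refine (map_add_le_add (p l) _ _).trans ?_
        rw [map_smul_eq_mul, map_smul_eq_mul, Real.norm_of_nonneg ha, Real.norm_of_nonneg hb]
    _ ≤ a * q.1 l.succ + b * q'.1 l.succ := by gcongr

lemma isCompact_weightedDecomp {d : ℕ} (N : Seminorm ℝ (Fin d → ℝ))
    (hN : ∀ x, N x = 0 → x = 0) : IsCompact (weightedDecomp N) := by
  obtain ⟨p, hp, hp0⟩ := exists_coordNorm_family N hN
  choose C hC using fun l => exists_bound (p l) (hp0 l)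
  have hcpt : IsCompact (stdSimplex ℝ (Fin (d + 1)) ×ˢ
      Set.pi Set.univ fun l => Metric.closedBall (0 : Fin d → ℝ) (C l)) :=
    (isCompact_stdSimplex ℝ _).prod (isCompact_univ_pi fun l => isCompact_closedBall _ _)
  refine hcpt.of_isClosed_subset ?_ ?_
  · have : weightedDecomp N = Prod.fst ⁻¹' stdSimplex ℝ (Fin (d + 1)) ∩
        ⋂ l, {q : (Fin (d + 1) → ℝ) × (Fin d → Fin d → ℝ) | p l (q.2 l) ≤ q.1 l.succ} := by
      ext q
      simp [weightedDecomp, hp]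
    rw [this]
    refine ((isClosed_stdSimplex ℝ _).preimage continuous_fst).inter (isClosed_iInter fun l => ?_)
    have := continuous_seminorm (p l)
    exact isClosed_le (by fun_prop) (by fun_prop)
  · rintro q ⟨hq1, hq2⟩
    refine ⟨hq1, fun l _ => ?_⟩
    rw [mem_closedBall_zero_iff]
    refine hC l _ ?_
    have h := hq2 l
    rw [hp] at h
    exact h.trans (stdSimplex.le_one ⟨q.1, hq1⟩ l.succ)

lemma isCompact_sumCost_image {d : ℕ} (N : Seminorm ℝ (Fin d → ℝ)) (hN : ∀ x, N x = 0 → x = 0)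
    (φ : Fin (d + 1) → ℝ) : IsCompact (sumCost φ '' weightedDecomp N) :=
  (isCompact_weightedDecomp N hN).image (sumCost φ).continuous_of_finiteDimensional

lemma mem_smul_coordBall {d : ℕ} (N : Seminorm ℝ (Fin d → ℝ)) (hN : ∀ x, N x = 0 → x = 0)
    (l : ℕ) {t : ℝ} (ht : 0 ≤ t) {z : Fin d → ℝ} :
    z ∈ t • coordBall N (l + 1) ↔ coordNorm N (l + 1) z ≤ t := by
  obtain ⟨p, hp, hp0⟩ := exists_coordNorm_eq N hN (Nat.le_add_left 1 l)
  rw [coordBall, if_neg (Nat.succ_ne_zero l), ← hp, Set.mem_smul_set]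
  constructor
  · rintro ⟨w, hw, rfl⟩
    rw [map_smul_eq_mul, Real.norm_of_nonneg ht]
    exact mul_le_of_le_one_right ht hw
  · intro h
    refine ⟨t⁻¹ • z, ?_, ?_⟩
    · change p (t⁻¹ • z) ≤ 1
      rw [map_smul_eq_mul, Real.norm_of_nonneg (by positivity)]
      exact inv_mul_le_one_of_le₀ h ht
    · rcases ht.eq_or_lt with rfl | h0
      · rw [zero_smul, hp0 z (le_antisymm h (apply_nonneg p z))]
      · rw [smul_inv_smul₀ h0.ne']

lemma exists_coordNorm_eq_one {d : ℕ} (hd : 1 ≤ d) (N : Seminorm ℝ (Fin d → ℝ))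
    (hN : ∀ x, N x = 0 → x = 0) (l : ℕ) : ∃ x, coordNorm N (l + 1) x = 1 := by
  obtain ⟨p, hp, hp0⟩ := exists_coordNorm_eq N hN (Nat.le_add_left 1 l)
  have he : (Pi.single ⟨0, hd⟩ 1 : Fin d → ℝ) ≠ 0 := by simp
  refine ⟨(p (Pi.single ⟨0, hd⟩ 1))⁻¹ • Pi.single ⟨0, hd⟩ 1, ?_⟩
  rw [← hp, map_smul_eq_mul, Real.norm_of_nonneg (by positivity),
    inv_mul_cancel₀ fun h => he (hp0 _ h)]

lemma mem_smul_coordSphere {d : ℕ} (hd : 1 ≤ d) (N : Seminorm ℝ (Fin d → ℝ))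
    (hN : ∀ x, N x = 0 → x = 0) (l : ℕ) {t : ℝ} (ht : 0 ≤ t) {z : Fin d → ℝ} :
    z ∈ t • coordSphere N (l + 1) ↔ coordNorm N (l + 1) z = t := by
  obtain ⟨e, he⟩ := exists_coordNorm_eq_one hd N hN l
  obtain ⟨p, hp, hp0⟩ := exists_coordNorm_eq N hN (Nat.le_add_left 1 l)
  rw [coordSphere, if_neg (Nat.succ_ne_zero l), ← hp, Set.mem_smul_set]
  rw [← hp] at he
  constructor
  · rintro ⟨w, hw, rfl⟩
    rw [map_smul_eq_mul, Real.norm_of_nonneg ht, show p w = 1 from hw, mul_one]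
  · rintro rfl
    by_cases h0 : p z = 0
    · -- `0 • S` is `{0}` only because the sphere `S` is nonempty
      exact ⟨e, he, by rw [h0, zero_smul, hp0 z h0]⟩
    · refine ⟨(p z)⁻¹ • z, ?_, smul_inv_smul₀ h0 z⟩
      change p _ = 1
      rw [map_smul_eq_mul, Real.norm_of_nonneg (by positivity), inv_mul_cancel₀ h0]

/-! ### The Fenchel conjugate of the Capra conjugate -/

lemma capraFenchel_eq {d : ℕ} (N : Seminorm ℝ (Fin d → ℝ)) (hN : ∀ x, N x = 0 → x = 0)
    (φ : Fin (d + 1) → EReal) :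
    capraFenchel N φ = coupConjRev fenchel
      (fun y => ⨆ l : Fin (d + 1), ((dualCoordNorm N l y : ℝ) : EReal) - φ l) := by
  rw [capraFenchel, coupConj_capra (isLUB_normalized_ell0 N hN)]

/-- Sets with the support functions of the coordinate balls yield the same biconjugate. -/
lemma capraFenchel_eq_coupBiconj {d : ℕ} (N : Seminorm ℝ (Fin d → ℝ))
    (hN : ∀ x, N x = 0 → x = 0) {B : ℕ → Set (Fin d → ℝ)}
    (hB : ∀ l y, IsLUB ((· ⬝ᵥ y) '' B l) (dualCoordNorm N l y)) (φ : Fin (d + 1) → EReal) :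
    capraFenchel N φ = coupBiconj fenchel (infOver B φ) := by
  rw [capraFenchel_eq N hN, coupBiconj, coupConj_infOver fun l _ => hB l]

lemma coupBiconj_capra {d : ℕ} (N : (Fin d → ℝ) → ℝ) (φ : Fin (d + 1) → EReal) (x : Fin d → ℝ) :
    coupBiconj (capra N) (φ ∘ ell0) x = capraFenchel N φ ((N x)⁻¹ • x) := by
  simp only [coupBiconj, capraFenchel, coupConjRev]
  rw [coupConj, coupConj]
  simp only [capra_eq_fenchel N x]

lemma infOver_coordBall {d : ℕ} (N : Seminorm ℝ (Fin d → ℝ)) (hN : ∀ x, N x = 0 → x = 0)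
    (φ : Fin (d + 1) → EReal) (l : Fin d) {x : Fin d → ℝ}
    (hx : x ∈ coordBall N (l + 1) \ coordBall N l) :
    infOver (coordBall N) φ x = ⨅ j : Fin (d + 1), ⨅ _ : l.succ ≤ j, φ j := by
  refine le_antisymm (le_iInf₂ fun j hj => infOver_le ?_) (le_sInf ?_)
  · exact coordBall_mono N hN hj hx.1
  · rintro _ ⟨j, hj, rfl⟩
    refine iInf₂_le j ?_
    by_contra hlt
    have : (j : ℕ) ≤ l := Nat.le_of_lt_succ (not_le.mp hlt)
    exact hx.2 (coordBall_mono N hN this hj)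

lemma infOver_coordBall_zero {d : ℕ} (N : Seminorm ℝ (Fin d → ℝ)) (hN : ∀ x, N x = 0 → x = 0)
    (φ : Fin (d + 1) → EReal) : infOver (coordBall N) φ 0 = ⨅ j : Fin (d + 1), φ j := by
  refine le_antisymm (le_iInf fun j => infOver_le (zero_mem_coordBall N hN j)) (le_sInf ?_)
  rintro _ ⟨j, -, rfl⟩
  exact iInf_le φ j

lemma infOver_coordBall_eq_top {d : ℕ} (N : Seminorm ℝ (Fin d → ℝ))
    (hN : ∀ x, N x = 0 → x = 0) (φ : Fin (d + 1) → EReal) {x : Fin d → ℝ}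
    (hx : x ∉ coordBall N d) : infOver (coordBall N) φ x = ⊤ := by
  refine top_le_iff.mp (le_sInf ?_)
  rintro _ ⟨j, hj, rfl⟩
  exact absurd (coordBall_mono N hN j.is_le hj) hx

lemma coordBall_self {d : ℕ} (hd : 1 ≤ d) (N : Seminorm ℝ (Fin d → ℝ))
    (hN : ∀ x, N x = 0 → x = 0) : coordBall N d = {x | N x ≤ 1} := by
  rw [coordBall, if_neg (by omega), coordNorm_eq_self N hN]

lemma lowerEnvelope_le_infOver {d : ℕ} (N : Seminorm ℝ (Fin d → ℝ)) (hN : ∀ x, N x = 0 → x = 0)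
    (φ : Fin (d + 1) → ℝ) :
    lowerEnvelope (sumCost φ '' weightedDecomp N)
      ≤ infOver (coordBall N) (fun l => (φ l : EReal)) := by
  obtain ⟨p, hp, -⟩ := exists_coordNorm_family N hN
  intro x
  refine le_sInf ?_
  rintro _ ⟨l, hl, rfl⟩
  refine lowerEnvelope_le ?_
  induction l using Fin.cases with
  | zero =>
    obtain rfl : x = 0 := by simpa [coordBall] using hl
    refine ⟨(Pi.single 0 1, 0), ⟨single_mem_stdSimplex ℝ _, fun l => ?_⟩, ?_⟩
    · simp [hp]
    · simp [sumCost, Pi.single_apply]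
  | succ l =>
    refine ⟨(Pi.single l.succ 1, Pi.single l x), ⟨single_mem_stdSimplex ℝ _, fun i => ?_⟩, ?_⟩
    · rw [hp]
      by_cases hi : i = l
      · subst hi
        have h : coordNorm N (i + 1) x ≤ 1 := by simpa [coordBall] using hl
        rw [hp] at h
        simpa using h
      · simp [hi]
    · simp [sumCost, Pi.single_apply]

/-- Jensen's inequality: a weighted decomposition of `x` is a convex combination of points of the
coordinate balls. -/
lemma capraFenchel_le_lowerEnvelope {d : ℕ} (N : Seminorm ℝ (Fin d → ℝ))
    (hN : ∀ x, N x = 0 → x = 0) (φ : Fin (d + 1) → ℝ) :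
    capraFenchel N (fun l => (φ l : EReal)) ≤ lowerEnvelope (sumCost φ '' weightedDecomp N) := by
  intro x
  refine le_sInf ?_
  rintro _ ⟨r, ⟨q, ⟨hq1, hq2⟩, hq⟩, rfl⟩
  set F := capraFenchel N (fun l => (φ l : EReal)) with hF
  have hconv : IsConvexFn F := (isClosedConvexFn_coupConjRev _).1
  have hle : F ≤ infOver (coordBall N) (fun l => (φ l : EReal)) := by
    rw [hF, capraFenchel_eq_coupBiconj N hN (isLUB_coordBall N hN)]
    exact coupBiconj_fenchel_le _
  have hw : ∀ l : Fin (d + 1), ∃ w ∈ coordBall N l,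
      q.1 l • w = (Fin.cons 0 q.2 : Fin (d + 1) → Fin d → ℝ) l := by
    intro l
    induction l using Fin.cases with
    | zero => exact ⟨0, zero_mem_coordBall N hN 0, by simp⟩
    | succ l =>
      obtain ⟨w, hw, hwz⟩ := (mem_smul_coordBall N hN l (hq1.1 l.succ)).mpr (hq2 l)
      exact ⟨w, by simpa using hw, by simpa using hwz⟩
  choose w hwB hwz using hw
  have hmem : ∑ l, q.1 l • (w l, φ l) ∈ epigraph F :=
    hconv.sum_mem (fun l _ => hq1.1 l) hq1.2 fun l _ => (hle _).trans (infOver_le (hwB l))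
  have hsum : ∑ l, q.1 l • (w l, φ l) = (x, r) := by
    rw [← hq]
    refine Prod.ext ?_ ?_
    · simp [Prod.fst_sum, hwz, Fin.sum_univ_succ, sumCost]
    · simp [Prod.snd_sum, sumCost]
  rw [hsum] at hmem
  exact hmem

lemma capraFenchel_eq_lowerEnvelope {d : ℕ} (N : Seminorm ℝ (Fin d → ℝ))
    (hN : ∀ x, N x = 0 → x = 0) (φ : Fin (d + 1) → ℝ) :
    capraFenchel N (fun l => (φ l : EReal)) = lowerEnvelope (sumCost φ '' weightedDecomp N) := by
  refine le_antisymm (capraFenchel_le_lowerEnvelope N hN φ) ?_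
  rw [capraFenchel_eq_coupBiconj N hN (isLUB_coordBall N hN)]
  exact (isClosedConvexFn_lowerEnvelope (isCompact_sumCost_image N hN φ)
    ((convex_weightedDecomp N hN).linear_image _)).le_coupBiconj
      (lowerEnvelope_le_infOver N hN φ)

lemma isMinOver_weightedDecomp {d : ℕ} (N : Seminorm ℝ (Fin d → ℝ))
    (hN : ∀ x, N x = 0 → x = 0) (φ : Fin (d + 1) → ℝ) (x : Fin d → ℝ) :
    IsMinOver {q | q ∈ weightedDecomp N ∧ ∑ l, q.2 l = x} (fun q => ∑ l, q.1 l * φ l)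
      (capraFenchel N (fun l => (φ l : EReal)) x) := by
  rw [capraFenchel_eq_lowerEnvelope N hN]
  refine isMinOver_lowerEnvelope (isCompact_sumCost_image N hN φ) ?_
  ext r
  constructor
  · rintro ⟨q, ⟨hq, rfl⟩, rfl⟩
    exact ⟨q, hq, rfl⟩
  · rintro ⟨q, hq, hqr⟩
    obtain ⟨h1, h2⟩ := Prod.mk.inj hqr
    exact ⟨q, ⟨hq, h1⟩, h2⟩

lemma capraFenchel_proper_convex_lsc {d : ℕ} (N : Seminorm ℝ (Fin d → ℝ))
    (hN : ∀ x, N x = 0 → x = 0) (φ : Fin (d + 1) → ℝ) :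
    IsProperFn (capraFenchel N (fun l => (φ l : EReal))) ∧
      IsConvexFn (capraFenchel N (fun l => (φ l : EReal))) ∧
      IsLscFn (capraFenchel N (fun l => (φ l : EReal))) := by
  have hP := isCompact_sumCost_image N hN φ
  have hbot := lowerEnvelope_ne_bot hP
  have hzero := lowerEnvelope_le_infOver N hN φ 0
  have hle : infOver (coordBall N) (fun l => (φ l : EReal)) 0 ≤ φ 0 :=
    infOver_le (zero_mem_coordBall N hN _)
  obtain ⟨hc, ⟨hl, -⟩ | h⟩ := isClosedConvexFn_lowerEnvelope hP
    ((convex_weightedDecomp N hN).linear_image _)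
  · rw [capraFenchel_eq_lowerEnvelope N hN]
    exact ⟨⟨hbot, 0, (hzero.trans hle).trans_lt (EReal.coe_lt_top _)⟩, hc, hl⟩
  · exact absurd (h 0) (hbot 0)

/-! ### The minimization formulas -/

lemma isMinOver_ball_weights {d : ℕ} (N : Seminorm ℝ (Fin d → ℝ))
    (hN : ∀ x, N x = 0 → x = 0) (φ : Fin (d + 1) → ℝ) (x : Fin d → ℝ) :
    IsMinOver
      {t : Fin (d + 1) → ℝ | t ∈ stdSimplex ℝ (Fin (d + 1)) ∧
        x ∈ ∑ l : Fin d, t l.succ • coordBall N (l + 1)}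
      (fun t => ∑ l : Fin (d + 1), t l * φ l)
      (capraFenchel N (fun l => (φ l : EReal)) x) := by
  refine (isMinOver_weightedDecomp N hN φ x).of_forall_exists_le ?_ ?_
  · rintro q ⟨⟨hq1, hq2⟩, rfl⟩
    refine ⟨q.1, ⟨hq1, Set.finsetSum_mem_finsetSum _ _ _ fun l _ => ?_⟩, le_rfl⟩
    exact (mem_smul_coordBall N hN l (hq1.1 l.succ)).mpr (hq2 l)
  · rintro t ⟨ht, hx⟩
    obtain ⟨z, hz, rfl⟩ := (Set.mem_fintype_sum _ _).mp hx
    exact ⟨(t, z), ⟨⟨ht, fun l => (mem_smul_coordBall N hN l (ht.1 l.succ)).mp (hz l)⟩, rfl⟩,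
      le_rfl⟩

/-- For nonnegative costs, the weights can be lowered to the norms of the vectors, the remaining
weight being put on the index zero at no cost. -/
lemma isMinOver_decomp {d : ℕ} (N : Seminorm ℝ (Fin d → ℝ))
    (hN : ∀ x, N x = 0 → x = 0) {φ : Fin (d + 1) → ℝ} (hφ : ∀ l, 0 ≤ φ l) (hφ0 : φ 0 = 0)
    (x : Fin d → ℝ) :
    IsMinOver
      {z : Fin d → Fin d → ℝ |
        ∑ l : Fin d, coordNorm N (l + 1) (z l) ≤ 1 ∧ ∑ l : Fin d, z l = x}
      (fun z => ∑ l : Fin d, φ l.succ * coordNorm N (l + 1) (z l))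
      (capraFenchel N (fun l => (φ l : EReal)) x) := by
  obtain ⟨p, hp, -⟩ := exists_coordNorm_family N hN
  refine (isMinOver_weightedDecomp N hN φ x).of_forall_exists_le ?_ ?_
  · rintro q ⟨⟨hq1, hq2⟩, rfl⟩
    refine ⟨q.2, ⟨?_, rfl⟩, ?_⟩
    · have h1 := hq1.2
      rw [Fin.sum_univ_succ] at h1
      have h2 := Finset.sum_le_sum fun l (_ : l ∈ Finset.univ) => hq2 l
      linarith [hq1.1 0]
    · simp only [Fin.sum_univ_succ, hφ0, mul_zero, zero_add]
      refine Finset.sum_le_sum fun l _ => ?_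
      rw [mul_comm]
      exact mul_le_mul_of_nonneg_right (hq2 l) (hφ _)
  · rintro z ⟨hz, rfl⟩
    refine ⟨(Fin.cons (1 - ∑ l : Fin d, coordNorm N (l + 1) (z l))
      fun l => coordNorm N (l + 1) (z l), z), ⟨⟨⟨fun l => ?_, ?_⟩, fun l => ?_⟩, rfl⟩, ?_⟩
    · induction l using Fin.cases with
      | zero => simpa using hz
      | succ l => simp [hp]
    · simp [Fin.sum_univ_succ]
    · simp
    · simp [Fin.sum_univ_succ, hφ0, mul_comm]

lemma isMinOver_sphere_weights {d : ℕ} (hd : 1 ≤ d) (N : Seminorm ℝ (Fin d → ℝ))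
    (hN : ∀ x, N x = 0 → x = 0) {φ : Fin (d + 1) → ℝ} (hφ : ∀ l, 0 ≤ φ l) (hφ0 : φ 0 = 0)
    (x : Fin d → ℝ) :
    IsMinOver
      {t : Fin (d + 1) → ℝ | t ∈ stdSimplex ℝ (Fin (d + 1)) ∧
        x ∈ ∑ l : Fin d, t l.succ • coordSphere N (l + 1)}
      (fun t => ∑ l : Fin d, t l.succ * φ l.succ)
      (capraFenchel N (fun l => (φ l : EReal)) x) := by
  obtain ⟨p, hp, -⟩ := exists_coordNorm_family N hN
  refine (isMinOver_decomp N hN hφ hφ0 x).of_forall_exists_le ?_ ?_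
  · rintro z ⟨hz, rfl⟩
    refine ⟨Fin.cons (1 - ∑ l : Fin d, coordNorm N (l + 1) (z l))
      fun l => coordNorm N (l + 1) (z l), ⟨⟨fun l => ?_, ?_⟩,
      Set.finsetSum_mem_finsetSum _ _ _ fun l _ => ?_⟩, ?_⟩
    · induction l using Fin.cases with
      | zero => simpa using hz
      | succ l => simp [hp]
    · simp [Fin.sum_univ_succ]
    · rw [Fin.cons_succ, mem_smul_coordSphere hd N hN l (by simp [hp])]
    · simp [mul_comm]
  · rintro t ⟨ht, hx⟩
    obtain ⟨z, hz, rfl⟩ := (Set.mem_fintype_sum _ _).mp hx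
    have hzt : ∀ l : Fin d, coordNorm N (l + 1) (z l) = t l.succ := fun l =>
      (mem_smul_coordSphere hd N hN l (ht.1 l.succ)).mp (hz l)
    refine ⟨z, ⟨?_, rfl⟩, ?_⟩
    · have h1 := ht.2
      rw [Fin.sum_univ_succ] at h1
      simp only [hzt]
      linarith [ht.1 0]
    · simp [hzt, mul_comm]

/-- This is the minimization formula at `x / N x`, rescaled by `N x`. The feasible set is nonempty
because the last coordinate norm is `N`, so that `x / N x` can be put on the last index alone. -/
lemma coupBiconj_capra_eq_min {d : ℕ} (hd : 1 ≤ d) (N : Seminorm ℝ (Fin d → ℝ))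
    (hN : ∀ x, N x = 0 → x = 0) {φ : Fin (d + 1) → ℝ} (hφ : ∀ l, 0 ≤ φ l) (hφ0 : φ 0 = 0)
    {x : Fin d → ℝ} (hx : x ≠ 0) :
    ∃ m : ℝ,
      IsLeast
        ((fun z : Fin d → Fin d → ℝ =>
            ∑ l : Fin d, coordNorm N (l + 1) (z l) * φ l.succ) ''
          {z | ∑ l : Fin d, coordNorm N (l + 1) (z l) ≤ N x ∧ ∑ l : Fin d, z l = x}) m ∧
      coupBiconj (capra N) ((fun l => (φ l : EReal)) ∘ ell0) x
        = ((1 / N x * m : ℝ) : EReal) := by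
  obtain ⟨p, hp, -⟩ := exists_coordNorm_family N hN
  have hpos : 0 < N x := lt_of_le_of_ne (apply_nonneg N x) fun h => hx (hN x h.symm)
  rw [coupBiconj_capra]
  have hmin := isMinOver_decomp N hN hφ hφ0 ((N x)⁻¹ • x)
  simp only [hp] at hmin ⊢
  have hlast : ∀ y, p ⟨d - 1, by omega⟩ y = N y := by
    intro y
    rw [← hp, show d - 1 + 1 = d by omega, coordNorm_eq_self N hN]
  have hscale : ∀ (c : ℝ) (_ : 0 < c) (l : Fin d) (w : Fin d → ℝ), p l (c • w) = c * p l w :=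
    fun c hc l w => by rw [map_smul_eq_mul, Real.norm_of_nonneg hc.le]
  obtain ⟨⟨z, ⟨hz1, hz2⟩, hz⟩, hlow⟩ := hmin.1 ⟨Pi.single ⟨d - 1, by omega⟩ ((N x)⁻¹ • x), by
    rw [Finset.sum_eq_single ⟨d - 1, by omega⟩ (fun l _ hl => by simp [hl]) (by simp),
      Pi.single_eq_same, hlast, map_smul_eq_mul, Real.norm_of_nonneg (by positivity),
      inv_mul_cancel₀ hpos.ne'], by simp⟩
  rw [← hz] at hlow ⊢
  refine ⟨N x * ∑ l, φ l.succ * p l (z l), ⟨⟨fun l => N x • z l, ⟨?_, ?_⟩, ?_⟩, ?_⟩, ?_⟩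
  · simp only [hscale _ hpos, ← Finset.mul_sum]
    exact mul_le_of_le_one_right hpos.le hz1
  · rw [← Finset.smul_sum, hz2, smul_inv_smul₀ hpos.ne']
  · simp only [hscale _ hpos, Finset.mul_sum]
    exact Finset.sum_congr rfl fun l _ => by ring
  · rintro _ ⟨w, ⟨hw1, hw2⟩, rfl⟩
    have h1 := hlow ⟨fun l => (N x)⁻¹ • w l, ⟨?_, ?_⟩, rfl⟩
    · simp only [hscale _ (inv_pos.mpr hpos), EReal.coe_le_coe_iff] at h1
      have h2 : ∑ l, φ l.succ * ((N x)⁻¹ * p l (w l)) = (N x)⁻¹ * ∑ l, p l (w l) * φ l.succ := by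
        rw [Finset.mul_sum]
        exact Finset.sum_congr rfl fun l _ => by ring
      rw [h2, ← div_eq_inv_mul, le_div_iff₀ hpos] at h1
      linarith
    · simp only [hscale _ (inv_pos.mpr hpos), ← Finset.mul_sum]
      exact inv_mul_le_one_of_le₀ hw1 hpos.le
    · rw [← Finset.smul_sum, hw2]
  · rw [one_div, inv_mul_cancel_left₀ hpos.ne']

end Capra

open Capra
theorem mainTheorem1 (d : ℕ) (hd : 1 ≤ d) (N : Seminorm ℝ (Fin d → ℝ))
    (hN : ∀ x, N x = 0 → x = 0) :
    -- extended real valued functions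
    (∀ φ : Fin (d + 1) → EReal,
      (∀ x : Fin d → ℝ, x ≠ 0 →
        coupBiconj (capra N) (φ ∘ ell0) x = capraFenchel N φ ((N x)⁻¹ • x)) ∧
      IsClosedConvexFn (capraFenchel N φ) ∧
      capraFenchel N φ = coupConjRev fenchel
        (fun y => ⨆ l : Fin (d + 1), ((dualCoordNorm N l y : ℝ) : EReal) - φ l) ∧
      -- balls
      capraFenchel N φ = coupBiconj fenchel (infChar (coordBall N) φ) ∧
      IsGreatest {g | IsClosedConvexFn g ∧ g ≤ infChar (coordBall N) φ} (capraFenchel N φ) ∧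
      infChar (coordBall N) φ = infOver (coordBall N) φ ∧
      (∀ l : Fin d, ∀ x ∈ coordBall N (l + 1) \ coordBall N l,
        infChar (coordBall N) φ x = ⨅ j : Fin (d + 1), ⨅ _ : l.succ ≤ j, φ j) ∧
      infChar (coordBall N) φ 0 = (⨅ j : Fin (d + 1), φ j) ∧
      (Monotone φ →
        (∀ l : Fin d, ∀ x ∈ coordBall N (l + 1) \ coordBall N l,
          infChar (coordBall N) φ x = φ l.succ) ∧
        infChar (coordBall N) φ 0 = φ 0) ∧
      coordBall N d = {x | N x ≤ 1} ∧
      (∀ x, x ∉ coordBall N d → infChar (coordBall N) φ x = ⊤) ∧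
      capraFenchel N φ = coupBiconj fenchel (infOver (coordBall N) φ) ∧
      -- spheres
      capraFenchel N φ = coupBiconj fenchel (infChar (coordSphere N) φ) ∧
      IsGreatest {g | IsClosedConvexFn g ∧ g ≤ infChar (coordSphere N) φ} (capraFenchel N φ) ∧
      infChar (coordSphere N) φ = infOver (coordSphere N) φ ∧
      capraFenchel N φ = coupBiconj fenchel (infOver (coordSphere N) φ)) ∧
    -- finite valued functions
    (∀ φ : Fin (d + 1) → ℝ,
      IsProperFn (capraFenchel N (fun l => (φ l : EReal))) ∧
      IsConvexFn (capraFenchel N (fun l => (φ l : EReal))) ∧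
      IsLscFn (capraFenchel N (fun l => (φ l : EReal))) ∧
      ∀ x : Fin d → ℝ,
        IsMinOver
          {t : Fin (d + 1) → ℝ | t ∈ stdSimplex ℝ (Fin (d + 1)) ∧
            x ∈ ∑ l : Fin d, t l.succ • coordBall N (l + 1)}
          (fun t => ∑ l : Fin (d + 1), t l * φ l)
          (capraFenchel N (fun l => (φ l : EReal)) x)) ∧
    -- nonnegative finite valued functions which vanish at zero
    (∀ φ : Fin (d + 1) → ℝ, (∀ l, 0 ≤ φ l) → φ 0 = 0 →
      IsProperFn (capraFenchel N (fun l => (φ l : EReal))) ∧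
      IsConvexFn (capraFenchel N (fun l => (φ l : EReal))) ∧
      IsLscFn (capraFenchel N (fun l => (φ l : EReal))) ∧
      (∀ x : Fin d → ℝ,
        IsMinOver
          {t : Fin (d + 1) → ℝ | t ∈ stdSimplex ℝ (Fin (d + 1)) ∧
            x ∈ ∑ l : Fin d, t l.succ • coordSphere N (l + 1)}
          (fun t => ∑ l : Fin d, t l.succ * φ l.succ)
          (capraFenchel N (fun l => (φ l : EReal)) x)) ∧
      (∀ x : Fin d → ℝ,
        IsMinOver
          {z : Fin d → Fin d → ℝ |
            ∑ l : Fin d, coordNorm N (l + 1) (z l) ≤ 1 ∧ ∑ l : Fin d, z l = x}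
          (fun z => ∑ l : Fin d, φ l.succ * coordNorm N (l + 1) (z l))
          (capraFenchel N (fun l => (φ l : EReal)) x)) ∧
      (∀ x : Fin d → ℝ, x ≠ 0 →
        ∃ m : ℝ,
          IsLeast
            ((fun z : Fin d → Fin d → ℝ =>
                ∑ l : Fin d, coordNorm N (l + 1) (z l) * φ l.succ) ''
              {z | ∑ l : Fin d, coordNorm N (l + 1) (z l) ≤ N x ∧ ∑ l : Fin d, z l = x}) m ∧
          coupBiconj (capra N) ((fun l => (φ l : EReal)) ∘ ell0) x
            = ((1 / N x * m : ℝ) : EReal))) := by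
  refine ⟨fun φ => ?_, fun φ => ?_, fun φ hφ hφ0 => ?_⟩
  · have hball := capraFenchel_eq_coupBiconj N hN (isLUB_coordBall N hN) φ
    have hsphere := capraFenchel_eq_coupBiconj N hN (isLUB_coordSphere hd N hN) φ
    rw [infChar_eq_infOver, infChar_eq_infOver]
    refine ⟨fun x _ => coupBiconj_capra N φ x, isClosedConvexFn_coupConjRev _,
      capraFenchel_eq N hN φ, hball, hball ▸ isGreatest_coupBiconj _, rfl,
      fun l x hx => infOver_coordBall N hN φ l hx, infOver_coordBall_zero N hN φ,
      fun hmono => ⟨fun l x hx => ?_, ?_⟩, coordBall_self hd N hN,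
      fun x hx => infOver_coordBall_eq_top N hN φ hx, hball, hsphere,
      hsphere ▸ isGreatest_coupBiconj _, rfl, hsphere⟩
    · rw [infOver_coordBall N hN φ l hx]
      exact le_antisymm (iInf₂_le l.succ le_rfl) (le_iInf₂ fun j hj => hmono hj)
    · rw [infOver_coordBall_zero N hN φ]
      exact le_antisymm (iInf_le φ 0) (le_iInf fun j => hmono (Fin.zero_le j))
  · obtain ⟨h1, h2, h3⟩ := capraFenchel_proper_convex_lsc N hN φ
    exact ⟨h1, h2, h3, isMinOver_ball_weights N hN φ⟩
  · obtain ⟨h1, h2, h3⟩ := capraFenchel_proper_convex_lsc N hN φ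
    exact ⟨h1, h2, h3, isMinOver_sphere_weights hd N hN hφ hφ0, isMinOver_decomp N hN hφ hφ0,
      fun x hx => coupBiconj_capra_eq_min hd N hN hφ hφ0 hx⟩
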